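/- **Setting.** A seller faces $T\ge 2$ rounds. The quality set is $\Omega=\{\bar\omega_1<\dots<\bar\omega_m\}\subset[0,1]$ with $\bar\omega_1=0$, $\bar\omega_m=1$ (so $m\ge2$) and $\bar\omega_{i+1}-\bar\omega_i$ constant; $\lambda$ is a prior on $\Omega$. Buyers' types are i.i.d. from an unknown law $F$ on $[0,1]$ with $\Pr[\theta\ge 1]=0$ and no other restriction. Valuations are $v(\theta,\omega)=\theta+\omega$, and prices lie in $[0,2]$. An advertising strategy is a family $\rho=(\rho_i)_{i\le m}$ of probability laws on $[0,1]$ (the law of the posterior mean $q$ when the quality is $\bar\omega_i$) that is Bayes-consistent: $\sum_i\lambda_i\bar\omega_i\rho_i(B)=\sum_i\lambda_i\int_B q\,\rho_i(dq)$ for all Borel $B$. In round $t$ the seller chooses $p_t,\rho_t$ from the past; then, independently of the past, $\theta_t\sim F$ and $\omega_t\sim\lambda$ are drawn independently, $q_t\sim\rho_{t,i}$ is drawn when $\omega_t=\bar\omega_i$, independently of $\theta_t$, and the buyer purchases ($a_t=1$) iff $\theta_t+q_t\ge p_t$. Put $$\mathrm{Rev}(p,\rho)=p\sum_i\lambda_i\int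 \Pr[\theta+q\ge p]\,\rho_i(dq),\qquad \mathrm{Regret}(T)=T\sup_{p,\rho}\mathrm{Rev}(p,\rho)-\sum_{t=1}^T\mathbb E[\mathrm{Rev}(p_t,\rho_t)].$$ **Algorithm 1 (parameter $\varepsilon$).** Let $\kappa(p,q)=((p-q)\wedge1)\vee0$, $\mathcal P=\{\varepsilon,2\varepsilon,\dots,2\}$, $\mathcal S=\{0,\varepsilon,\dots,1\}\cup\{\kappa(p,\omega):p\in\mathcal P,\omega\in\Omega\}$ and $\mathcal Q_p=\{q\in[0,1]:\kappa(p,q)\in\mathcal S\}$. In the first $|\mathcal S|$ rounds, for each $x\in\mathcal S$ once, use the uninformative advertising ($q_t=\mathbb E_\lambda[\omega]$) with a price $p\in[0,2]$ such that $\kappa(p,\mathbb E_\lambda[\omega])=x$. In each later round $t\le T$, let $N_t(x)$ be the number of $\tau<t$ with $\kappa(p_\tau,q_\tau)=x$, let $\bar D_t(x)$ be the average of $a_\tau$ over these $\tau$, and let $$D^{\mathrm{UCB}}_t(x)=\min_{x'\in\mathcal S,\,x'\le x}\Big(\bar D_t(x')+\sqrt{\tfrac{16\log T}{N_t(x')}}+\tfrac{\sqrt{(1+N_t(x'))\log(1+N_t(x'))}}{N_t(x')}\Big)\wedge1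 .$$ Play any maximizer $(p_t,\rho_t)$ of $p\sum_i\lambda_i\int D^{\mathrm{UCB}}_t(\kappa(p,q))\,\rho_i(dq)$ over $p\in\mathcal P$ and Bayes-consistent $\rho$ with all $\rho_i$ supported in $\mathcal Q_p$. **Theorem (additive and uniformly-spaced).** Let $g=(\log T/T)^{1/3}\wedge \frac1m$. For all $m,T\ge2$ there is $\varepsilon\in[\frac12 g,g]$ such that $\frac{1}{(m-1)\varepsilon}$ is an integer. Moreover, for all constants $c_1,c_2>0$ there is a constant $C$, depending only on $c_1,c_2$, such that for all $m$, all $T\ge2$, every market as above, and every $\varepsilon$ with $c_1g\le\varepsilon\le c_2g$ and $\frac1{(m-1)\varepsilon}$ an integer, Algorithm 1 with parameter $\varepsilon$ satisfies $$\mathrm{Regret}(T)\le C\big(T^{2/3}(\log T)^{1/3}+\sqrt{mT\log T}\big).$$ Consequently $\mathrm{Regret}(T)\le C\,T^{2/3}(\log T)^{1/3}=\tilde O(T^{2/3})$, independently of $m$, if $m\le (T/\log T)^{1/3}$, and $\mathrm{Regret}(T)\le C\sqrt{mT\log T}$ if $m>(T/\log T)^{1/3}$. -/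

import Mathlib

open Real Set MeasureTheory ProbabilityTheory

namespace Persuasion

noncomputable section

/-- The data of a market: `m` qualities `0 = ω₁ < … < ω_m = 1`, a prior on the qualities, and the
law on `Θ = [0,1]` of the private type of a buyer.

The last field says `ℙ(θ ≥ 1) = 0`.  The demand function is `D = 1 - F` for a CDF `F` on `[0,1]`,
hence `D(1) = 0`, and `D(x)` is the probability that the type is at least `x`.  Atoms at all other
points are allowed. -/
structure Market (m : ℕ) where
  quality : Fin m → ℝ
  quality_strictMono : StrictMono quality
  quality_least : IsLeast (range quality) 0
  quality_greatest : IsGreatest (range quality) 1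
  prior : Fin m → ℝ
  prior_mem : prior ∈ stdSimplex ℝ (Fin m)
  typeLaw : Measure ℝ
  typeLaw_prob : IsProbabilityMeasure typeLaw
  typeLaw_support : typeLaw (Icc 0 1)ᶜ = 0
  typeLaw_one : typeLaw {1} = 0

/-- Consecutive elements of the ordered set differ by a constant. -/
def EquallySpaced {m : ℕ} (quality : Fin m → ℝ) : Prop :=
  ∃ c : ℝ, ∀ i j : Fin m, (j : ℕ) = i + 1 → quality j - quality i = c

/-- The additive valuation `v(θ, ω) = θ + ω`. -/
def additive (θ w : ℝ) : ℝ := θ + w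

/-- The critical type `κ(p, q) = min {θ ∈ [0,1] : v(θ, q) ≥ p}`, with the value `1` if no type is
willing to pay `p`.  For the additive valuation this is `((p - q) ∧ 1) ∨ 0`. -/
def criticalType (v : ℝ → ℝ → ℝ) (p q : ℝ) : ℝ :=
  sInf (insert 1 {θ | θ ∈ Icc (0 : ℝ) 1 ∧ p ≤ v θ q})

/-- An advertising strategy is a family of conditional laws `ρ i` of the posterior mean, given that
the quality is the `i`-th one.  It is feasible with support in `Q` if the `ρ i` are probability
measures on `Q` that are Bayes-consistent: where `ρ = ∑ i, λ i • ρ i`, the conditional mean of the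
quality given the posterior mean `q` is `q`, for `ρ`-almost all `q`. -/
structure Feasible {m : ℕ} (M : Market m) (Q : Set ℝ) (ρ : Fin m → Measure ℝ) : Prop where
  prob : ∀ i, IsProbabilityMeasure (ρ i)
  support : ∀ i, ρ i Qᶜ = 0
  bayes : ∀ B : Set ℝ, MeasurableSet B →
    ∑ i, M.prior i * M.quality i * (ρ i).real B = ∑ i, M.prior i * ∫ q in B, q ∂(ρ i)

/-- Expected revenue of one round, `p · ∑ i, λ i ∫ ρ i (dq) ℙ(v(θ, q) ≥ p)`: the buyer who holds
the posterior mean `q` purchases if and only if `v(θ, q) ≥ p`. -/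
def rev {m : ℕ} (v : ℝ → ℝ → ℝ) (M : Market m) (p : ℝ) (ρ : Fin m → Measure ℝ) : ℝ :=
  p * ∑ i, M.prior i * ∫ q, M.typeLaw.real {θ | p ≤ v θ q} ∂(ρ i)

/-- The optimal expected revenue of one round, over all prices in `[0, U]` and all feasible
advertising strategies. -/
def optRev {m : ℕ} (v : ℝ → ℝ → ℝ) (U : ℝ) (M : Market m) : ℝ :=
  sSup {r | ∃ p ∈ Icc 0 U, ∃ ρ, Feasible M (Icc 0 1) ρ ∧ r = rev v M p ρ}

/-- The price grid `𝒫 = {ε, 2ε, …, U}`. -/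
def priceGrid (U ε : ℝ) : Finset ℝ :=
  (Finset.Icc 1 ⌊U / ε⌋₊).image fun k : ℕ => (k : ℝ) * ε

/-- The type grid `𝒮 = {0, ε, …, 1 - ε, 1} ∪ {κ(p, ω) : p ∈ 𝒫, ω ∈ Ω}`. -/
def typeGrid {m : ℕ} (v : ℝ → ℝ → ℝ) (U : ℝ) (M : Market m) (ε : ℝ) : Finset ℝ :=
  insert 1 ((Finset.range (⌊1 / ε⌋₊ + 1)).image fun k : ℕ => (k : ℝ) * ε) ∪
    (priceGrid U ε ×ˢ Finset.univ).image fun x : ℝ × Fin m => criticalType v x.1 (M.quality x.2)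

/-- The admissible posterior means `𝒬_p = {q ∈ [0,1] : κ(p, q) ∈ 𝒮}` at the price `p`. -/
def postGrid {m : ℕ} (v : ℝ → ℝ → ℝ) (U : ℝ) (M : Market m) (ε p : ℝ) : Set ℝ :=
  {q | q ∈ Icc (0 : ℝ) 1 ∧ criticalType v p q ∈ typeGrid v U M ε}

/-- The rounds before round `t` whose critical type is exactly `x`, along a path of prices `p` and
realized posterior means `q`. -/
def visits (v : ℝ → ℝ → ℝ) (p q : ℕ → ℝ) (t : ℕ) (x : ℝ) : Finset ℕ :=
  (Finset.range t).filter fun τ => criticalType v (p τ) (q τ) = x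

/-- The purchase decision of a type `θ` at price `p` and posterior mean `q`. -/
def purchase (v : ℝ → ℝ → ℝ) (p q θ : ℝ) : ℝ := if p ≤ v θ q then 1 else 0

/-- The empirical demand at `x` before round `t`, plus its confidence radius. -/
def index (v : ℝ → ℝ → ℝ) (T : ℕ) (p q θ : ℕ → ℝ) (t : ℕ) (x : ℝ) : ℝ :=
  let N : ℝ := (visits v p q t x).card
  (∑ τ ∈ visits v p q t x, purchase v (p τ) (q τ) (θ τ)) / N +
    √(16 * log T / N) + √((1 + N) * log (1 + N)) / N

/-- The upper confidence bound `D^UCB_t(x)`: the minimum of `1` and of the indices of all grid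
points `x' ≤ x`. -/
def ucb (v : ℝ → ℝ → ℝ) (S : Finset ℝ) (T : ℕ) (p q θ : ℕ → ℝ) (t : ℕ) (x : ℝ) : ℝ :=
  (S.filter (· ≤ x)).fold min 1 (index v T p q θ t)

/-- The revenue of `(p, ρ)` if the demand function is `D`. -/
def estRev {m : ℕ} (v : ℝ → ℝ → ℝ) (M : Market m) (D : ℝ → ℝ) (p : ℝ) (ρ : Fin m → Measure ℝ) :
    ℝ :=
  p * ∑ i, M.prior i * ∫ q, D (criticalType v p q) ∂(ρ i)

/-- `(p, ρ)` maximizes the revenue for the demand function `D` over all prices in `𝒫` and all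
feasible advertising strategies with support in `𝒬_p`. -/
def IsOptimal {m : ℕ} (v : ℝ → ℝ → ℝ) (U : ℝ) (M : Market m) (ε : ℝ) (D : ℝ → ℝ)
    (p : ℝ) (ρ : Fin m → Measure ℝ) : Prop :=
  (p ∈ priceGrid U ε ∧ Feasible M (postGrid v U M ε p) ρ) ∧
    ∀ p' ∈ priceGrid U ε, ∀ ρ', Feasible M (postGrid v U M ε p') ρ' →
      estRev v M D p' ρ' ≤ estRev v M D p ρ

/-- A run over `T` rounds, numbered from `0`, of the pricing and advertising algorithm with
discretization parameter `ε`.  In round `t` the seller posts `price t` and `adv t`; then the type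
`θ t` of the buyer, the (index of the) quality `ω t` and the posterior mean `q t` are drawn. The
sigma-algebra `ℱ t` holds the events that are determined before round `t`. It may be larger than
the one generated by the past rounds: optimal solutions may be chosen in any way, also at random. -/
structure IsRun {m : ℕ} (v : ℝ → ℝ → ℝ) (U : ℝ) (M : Market m) (ε : ℝ) (T : ℕ)
    {Ω' : Type*} [mΩ' : MeasurableSpace Ω'] (P : Measure Ω') (ℱ : Filtration ℕ mΩ')
    (price : ℕ → Ω' → ℝ) (adv : ℕ → Ω' → Fin m → Measure ℝ)
    (θ : ℕ → Ω' → ℝ) (ω : ℕ → Ω' → Fin m) (q : ℕ → Ω' → ℝ) : Prop where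
  price_meas : ∀ t < T, Measurable[ℱ t] (price t)
  adv_meas : ∀ t < T, ∀ i, Measurable[ℱ t] fun s => adv t s i
  type_meas : ∀ t < T, Measurable[ℱ (t + 1)] (θ t)
  quality_meas : ∀ t < T, Measurable[ℱ (t + 1)] (ω t)
  post_meas : ∀ t < T, Measurable[ℱ (t + 1)] (q t)
  /-- Given the past, the type has the law `F` and is independent of the quality and the posterior
  mean; the quality has the prior law, and `q t` has the law `adv t i` given the quality `i`. -/
  law : ∀ t < T, ∀ A B : Set ℝ, MeasurableSet A → MeasurableSet B → ∀ i : Fin m,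
    P⟦θ t ⁻¹' A ∩ ω t ⁻¹' {i} ∩ q t ⁻¹' B | ℱ t⟧
      =ᵐ[P] fun s => M.typeLaw.real A * M.prior i * (adv t s i).real B
  /-- The first `|𝒮|` rounds use no information advertising, with one round for each `x ∈ 𝒮`. -/
  init : ∀ s, ∃ e : Fin (typeGrid v U M ε).card ≃ typeGrid v U M ε,
    ∀ t < T, ∀ ht : t < (typeGrid v U M ε).card,
      price t s ∈ Icc 0 U ∧
      (∀ i, adv t s i = Measure.dirac (∑ j, M.prior j * M.quality j)) ∧
      criticalType v (price t s) (∑ j, M.prior j * M.quality j) = e ⟨t, ht⟩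
  /-- Each later round uses an optimal solution for the current upper confidence bounds. -/
  main : ∀ s, ∀ t < T, (typeGrid v U M ε).card ≤ t →
    IsOptimal v U M ε
      (ucb v (typeGrid v U M ε) T (fun τ => price τ s) (fun τ => q τ s) (fun τ => θ τ s) t)
      (price t s) (adv t s)

/-- Expected regret over `T` rounds. -/
def regret {m : ℕ} (v : ℝ → ℝ → ℝ) (U : ℝ) (M : Market m) (T : ℕ)
    {Ω' : Type*} [MeasurableSpace Ω'] (P : Measure Ω')
    (price : ℕ → Ω' → ℝ) (adv : ℕ → Ω' → Fin m → Measure ℝ) : ℝ :=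
  T * optRev v U M - ∑ t ∈ Finset.range T, ∫ s, rev v M (price t s) (adv t s) ∂P

/-- The order `(log T / T)^{1/3} ∧ 1/m` of the discretization parameter. -/
def scale (m T : ℕ) : ℝ := min ((log T / T) ^ (1 / 3 : ℝ)) (1 / m)

end

end Persuasion

namespace Persuasion

/-! ### Critical types, demand and grids -/

/-! The regret splits into a discretization loss and a learning loss, which `ε` balances.

Discretization (`exists_grid_strategy`). Lower the price by between `ε` and `2ε` to a grid price,
and round each posterior mean down to a multiple of `ε`. The mean falls by less than `ε` and the
price by at least `ε`, so no critical type rises and no sale is lost; the revenue drops by at most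
`2ε`. This uses monotonicity of the demand alone, so the type law may be arbitrary. Rounding down
breaks Bayes consistency, because a cell has mean at least its left end. The repair is to take a
part of the higher qualities out of the pool and reveal them, which only helps sales
(`exists_pooling`, `exists_grid_adv`).

Learning. A purchase at critical type `x` is a Bernoulli sample of the demand at `x`, so each point
of `𝒮` is an arm. An exponential supermartingale and a union bound show that the upper confidence
bounds dominate the demand up to a small failure probability (`Samples.measure_badEvent_le`). By
optimism a main round then loses at most `2ε` plus a multiple of the expected confidence radius at
the random critical type (`IsRun.regret_le_of_notMem`). The radii are charged to realized visits,
and Cauchy–Schwarz bounds their sum by the order of `√(|𝒮| T log T)` (`sum_hit_div_sqrt_count_le`).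

With equal spacing all qualities are multiples of `ε`, so `|𝒮| ≤ 1/ε + 1` without a factor `m`
(`card_typeGrid_le`). The total `2εT + O(√(T log T / ε))`, with `ε` of order `(log T / T)^{1/3} ∧
1/m`, gives the theorem. -/

lemma criticalType_additive (p q : ℝ) : criticalType additive p q = min 1 (max 0 (p - q)) := by
  refine IsLeast.csInf_eq ⟨?_, ?_⟩
  · rcases le_total 1 (max 0 (p - q)) with h | h
    · rw [min_eq_left h]; exact mem_insert _ _
    · rw [min_eq_right h]
      refine mem_insert_of_mem _ ⟨⟨le_max_left _ _, h⟩, ?_⟩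
      have := le_max_right 0 (p - q)
      simp only [additive]; linarith
  · rintro x (rfl | ⟨⟨h0, -⟩, h⟩)
    · exact min_le_left _ _
    · simp only [additive] at h
      exact (min_le_right _ _).trans (max_le h0 (by linarith))

lemma criticalType_additive_mono {p q p' q' : ℝ} (h : p' - q' ≤ p - q) :
    criticalType additive p' q' ≤ criticalType additive p q := by
  simp only [criticalType_additive]
  gcongr

/-- Type `1` must be excluded: the critical type is `1` both when only type `1` buys and when nobody
does. This is why the type law may have no atom at `1`. -/
lemma le_additive_iff {p q θ : ℝ} (h : θ ∈ Ico (0 : ℝ) 1) :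
    p ≤ additive θ q ↔ criticalType additive p q ≤ θ := by
  rw [criticalType_additive, min_le_iff, max_le_iff, additive, sub_le_iff_le_add]
  have := h.1
  have := h.2
  constructor
  · intro h'; exact .inr ⟨h.1, h'⟩
  · rintro (h' | h')
    · linarith
    · exact h'.2

lemma measurable_criticalType_additive :
    Measurable fun x : ℝ × ℝ => criticalType additive x.1 x.2 := by
  simp only [criticalType_additive]
  fun_prop

lemma Market.two_le {m : ℕ} (M : Market m) : 2 ≤ m := by
  obtain ⟨i, hi⟩ := M.quality_least.1
  obtain ⟨j, hj⟩ := M.quality_greatest.1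
  have hij : i ≠ j := by rintro rfl; linarith
  have := i.2
  have := j.2
  have : (i : ℕ) ≠ j := fun h => hij (Fin.ext h)
  omega

lemma Market.quality_mem {m : ℕ} (M : Market m) (i : Fin m) : M.quality i ∈ Icc (0 : ℝ) 1 :=
  ⟨M.quality_least.2 ⟨i, rfl⟩, M.quality_greatest.2 ⟨i, rfl⟩⟩

/-- The probability that the type is at least `x`. -/
noncomputable def Market.demand {m : ℕ} (M : Market m) (x : ℝ) : ℝ := M.typeLaw.real (Ici x)

lemma Market.demand_nonneg {m : ℕ} (M : Market m) (x : ℝ) : 0 ≤ M.demand x := measureReal_nonneg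

lemma Market.demand_le_one {m : ℕ} (M : Market m) (x : ℝ) : M.demand x ≤ 1 :=
  have := M.typeLaw_prob
  measureReal_le_one

lemma Market.demand_antitone {m : ℕ} (M : Market m) : Antitone M.demand := fun _ _ h =>
  have := M.typeLaw_prob
  measureReal_mono (Ici_subset_Ici.2 h)

lemma Market.typeLaw_compl_Ico {m : ℕ} (M : Market m) : M.typeLaw (Ico 0 1)ᶜ = 0 := by
  refine measure_mono_null (t := (Icc 0 1)ᶜ ∪ {1}) ?_
    (measure_union_null M.typeLaw_support M.typeLaw_one)
  intro x hx
  by_cases h : x = 1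
  · exact .inr h
  · refine .inl fun h' => hx ⟨h'.1, lt_of_le_of_ne h'.2 h⟩

lemma Market.typeLaw_real_purchase {m : ℕ} (M : Market m) (p q : ℝ) :
    M.typeLaw.real {θ | p ≤ additive θ q} = M.demand (criticalType additive p q) := by
  refine measureReal_congr ?_
  have h : ∀ᵐ x ∂M.typeLaw, x ∈ Ico (0 : ℝ) 1 := by
    rw [ae_iff]; exact M.typeLaw_compl_Ico
  filter_upwards [h] with x hx
  exact propext (le_additive_iff hx)

lemma rev_additive {m : ℕ} (M : Market m) (p : ℝ) (ρ : Fin m → Measure ℝ) :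
    rev additive M p ρ = estRev additive M M.demand p ρ := by
  simp only [rev, estRev, M.typeLaw_real_purchase]

lemma sum_prior_mul_le {m : ℕ} (M : Market m) {f : Fin m → ℝ} {c : ℝ} (h : ∀ i, f i ≤ c) :
    ∑ i, M.prior i * f i ≤ c := by
  calc ∑ i, M.prior i * f i ≤ ∑ i, M.prior i * c :=
        Finset.sum_le_sum fun i _ => mul_le_mul_of_nonneg_left (h i) (M.prior_mem.1 i)
    _ = c := by rw [← Finset.sum_mul, M.prior_mem.2, one_mul]

lemma estRev_nonneg {m : ℕ} (M : Market m) {D : ℝ → ℝ} (hD : ∀ x, 0 ≤ D x) {p : ℝ} (hp : 0 ≤ p)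
    (ρ : Fin m → Measure ℝ) : 0 ≤ estRev additive M D p ρ :=
  mul_nonneg hp (Finset.sum_nonneg fun i _ =>
    mul_nonneg (M.prior_mem.1 i) (integral_nonneg fun _ => hD _))

lemma Feasible.sum_prior_integral_le_one {m : ℕ} {M : Market m} {Q : Set ℝ}
    {ρ : Fin m → Measure ℝ} (hρ : Feasible M Q ρ) {f : ℝ → ℝ} (h0 : ∀ x, 0 ≤ f x)
    (h1 : ∀ x, f x ≤ 1) : ∑ i, M.prior i * ∫ q, f q ∂(ρ i) ≤ 1 := by
  refine sum_prior_mul_le M fun i => ?_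
  have := hρ.prob i
  calc ∫ q, f q ∂(ρ i) ≤ ∫ _, (1 : ℝ) ∂(ρ i) :=
        integral_mono_of_nonneg (.of_forall h0) (integrable_const _) (.of_forall h1)
    _ = 1 := by simp

lemma rev_additive_le {m : ℕ} {M : Market m} {Q : Set ℝ} {p : ℝ} {ρ : Fin m → Measure ℝ}
    (hp : 0 ≤ p) (hρ : Feasible M Q ρ) : rev additive M p ρ ≤ p := by
  rw [rev_additive]
  exact mul_le_of_le_one_right hp
    (hρ.sum_prior_integral_le_one (fun _ => M.demand_nonneg _) fun _ => M.demand_le_one _)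

/-- Throughout, `n` is the integer `1 / ε`, which makes the floors in the grids exact. -/
lemma mem_priceGrid {ε : ℝ} {n : ℕ} (hε : n * ε = 1) {p : ℝ} :
    p ∈ priceGrid 2 ε ↔ ∃ k : ℕ, 1 ≤ k ∧ k ≤ 2 * n ∧ (k : ℝ) * ε = p := by
  have h0 : ε ≠ 0 := by rintro rfl; simp at hε
  have h : (2 : ℝ) / ε = (2 * n : ℕ) := by
    rw [div_eq_iff h0]; push_cast; linarith
  simp only [priceGrid, h, Nat.floor_natCast, Finset.mem_image, Finset.mem_Icc, and_assoc]

lemma mul_mem_typeGrid {m : ℕ} (M : Market m) {ε : ℝ} {n : ℕ} (hε : n * ε = 1) {k : ℕ}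
    (hk : k ≤ n) : (k : ℝ) * ε ∈ typeGrid additive 2 M ε := by
  have h0 : ε ≠ 0 := by rintro rfl; simp at hε
  have h : (1 : ℝ) / ε = n := by rw [div_eq_iff h0, hε]
  refine Finset.mem_union_left _ (Finset.mem_insert_of_mem (Finset.mem_image.2 ⟨k, ?_, rfl⟩))
  rw [h, Nat.floor_natCast, Finset.mem_range]
  omega

/-- Truncated subtraction in `ℕ` is the maximum with `0`, and the minimum with `n` is the cap at
`1`. -/
lemma criticalType_additive_mul {ε : ℝ} (h0 : 0 < ε) {n : ℕ} (hε : n * ε = 1) (k j : ℕ) :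
    criticalType additive (k * ε) (j * ε) = (min n (k - j) : ℕ) * ε := by
  rw [criticalType_additive, ← sub_mul]
  rcases le_total k j with h | h
  · have : ((k : ℝ) - j) * ε ≤ 0 :=
      mul_nonpos_of_nonpos_of_nonneg (by simpa using h) h0.le
    simp [max_eq_left this, Nat.sub_eq_zero_of_le h]
  · rw [max_eq_right (mul_nonneg (by simpa using h) h0.le), Nat.cast_min, Nat.cast_sub h,
      min_mul_of_nonneg _ _ h0.le, hε]

/-- When the qualities are multiples of `ε`, the critical types at the qualities are again multiples
of `ε` and add no points. In general there could be a number of order `n * m` of them. -/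
lemma card_typeGrid_le {m : ℕ} (M : Market m) {ε : ℝ} (h0 : 0 < ε) {n : ℕ} (hε : n * ε = 1)
    (hq : ∀ i, ∃ k : ℕ, M.quality i = k * ε) : (typeGrid additive 2 M ε).card ≤ n + 1 := by
  have hsub : typeGrid additive 2 M ε ⊆ (Finset.range (n + 1)).image fun k : ℕ => (k : ℝ) * ε := by
    have h : (1 : ℝ) / ε = n := by rw [div_eq_iff h0.ne', hε]
    intro x hx
    simp only [typeGrid, h, Nat.floor_natCast, Finset.mem_union, Finset.mem_insert] at hx
    rcases hx with (rfl | hx) | hx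
    · exact Finset.mem_image.2 ⟨n, by simp, hε⟩
    · exact hx
    · simp only [Finset.mem_image, Finset.mem_product, Finset.mem_univ, and_true, Prod.exists] at hx
      obtain ⟨p, i, hp, rfl⟩ := hx
      obtain ⟨k, -, -, rfl⟩ := (mem_priceGrid hε).1 hp
      obtain ⟨j, hj⟩ := hq i
      rw [hj, criticalType_additive_mul h0 hε]
      exact Finset.mem_image.2 ⟨_, by simp, rfl⟩
  calc _ ≤ _ := Finset.card_le_card hsub
    _ ≤ _ := Finset.card_image_le
    _ = n + 1 := Finset.card_range _

lemma quality_mem_postGrid {m : ℕ} (M : Market m) {ε p : ℝ} (hp : p ∈ priceGrid 2 ε) (i : Fin m) :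
    M.quality i ∈ postGrid additive 2 M ε p :=
  ⟨M.quality_mem i, Finset.mem_union_right _
    (Finset.mem_image.2 ⟨(p, i), by simpa using hp, rfl⟩)⟩

lemma mul_mem_postGrid {m : ℕ} (M : Market m) {ε p : ℝ} (h0 : 0 < ε) {n : ℕ} (hε : n * ε = 1)
    (hp : p ∈ priceGrid 2 ε) {k : ℕ} (hk : k ≤ n) :
    (k : ℝ) * ε ∈ postGrid additive 2 M ε p := by
  obtain ⟨j, -, -, rfl⟩ := (mem_priceGrid hε).1 hp
  refine ⟨⟨by positivity, ?_⟩, ?_⟩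
  · rw [← hε]; gcongr
  · rw [criticalType_additive_mul h0 hε]
    exact mul_mem_typeGrid M hε (min_le_left _ _)

/-! ### Functions with finitely many values -/

lemma integral_comp_of_ae_mem_finset {α β : Type*} [MeasurableSpace α]
    {μ : Measure α} [IsFiniteMeasure μ] {f : α → β} {S : Finset β}
    (hf : ∀ x ∈ S, MeasurableSet (f ⁻¹' {x})) (h : ∀ᵐ a ∂μ, f a ∈ S) (g : β → ℝ) :
    Integrable (fun a => g (f a)) μ ∧ ∫ a, g (f a) ∂μ = ∑ x ∈ S, g x * μ.real (f ⁻¹' {x}) := by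
  classical
  have hi : ∀ x ∈ S, Integrable ((f ⁻¹' {x}).indicator fun _ => g x) μ := fun x hx =>
    (integrable_const _).indicator (hf x hx)
  have hae : (fun a => ∑ x ∈ S, (f ⁻¹' {x}).indicator (fun _ => g x) a) =ᵐ[μ]
      fun a => g (f a) := by
    filter_upwards [h] with a ha
    rw [Finset.sum_eq_single_of_mem (f a) ha]
    · simp
    · intro x _ hx
      exact indicator_of_notMem (fun h => hx h.symm) _
  refine ⟨(integrable_finsetSum S hi).congr hae, ?_⟩
  rw [← integral_congr_ae hae, integral_finsetSum S hi]
  refine Finset.sum_congr rfl fun x hx => ?_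
  rw [integral_indicator_const _ (hf x hx), smul_eq_mul, mul_comm]

/-! ### Rounding a strategy to the grid -/

/-- `W i` is the mass of quality `w i` in a cell, and `c i` the fraction that stays in the pool. All
qualities up to `a` stay; of the others a common fraction stays, chosen so that their surplus over
`a` equals the deficit of the low ones. -/
lemma exists_pooling {ι : Type*} [Fintype ι] {W w : ι → ℝ} (hW : ∀ i, 0 ≤ W i) {a : ℝ}
    (h : 0 ≤ ∑ i, W i * (w i - a)) :
    ∃ c : ι → ℝ, (∀ i, 0 ≤ c i) ∧ (∀ i, c i ≤ 1) ∧ (∀ i, w i ≤ a → c i = 1) ∧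
      ∑ i, W i * c i * (w i - a) = 0 := by
  classical
  set AH := ∑ i, if w i ≤ a then 0 else W i * (w i - a) with hAH
  set AL := ∑ i, if w i ≤ a then W i * (a - w i) else 0 with hAL
  have hL : 0 ≤ AL := Finset.sum_nonneg fun i _ => by
    split_ifs with hi
    · exact mul_nonneg (hW i) (by linarith)
    · exact le_rfl
  have hdiff : ∑ i, W i * (w i - a) = AH - AL := by
    rw [hAH, hAL, ← Finset.sum_sub_distrib]
    refine Finset.sum_congr rfl fun i _ => ?_
    split_ifs <;> ring
  have hLH : AL ≤ AH := by linarith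
  refine ⟨fun i => if w i ≤ a then 1 else AL / AH, fun i => ?_, fun i => ?_, fun i hi => ?_, ?_⟩
  · dsimp only; split_ifs
    · exact zero_le_one
    · exact div_nonneg hL (hL.trans hLH)
  · dsimp only; split_ifs
    · exact le_rfl
    · exact div_le_one_of_le₀ hLH (hL.trans hLH)
  · simp [hi]
  · have : ∑ i, W i * (if w i ≤ a then 1 else AL / AH) * (w i - a) = AL / AH * AH - AL := by
      conv_rhs => rw [hAL]; enter [1, 2]; rw [hAH]
      rw [← hAL, Finset.mul_sum, hAL, ← Finset.sum_sub_distrib]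
      refine Finset.sum_congr rfl fun i _ => ?_
      split_ifs <;> ring
    rw [this]
    -- If there is no surplus, there is no deficit either, and the value `0` of `AL / 0` does no
    -- harm.
    rcases eq_or_ne AH 0 with h0 | h0
    · have : AL = 0 := by linarith
      simp [this]
    · rw [div_mul_cancel₀ _ h0, sub_self]

lemma feasible_reveal {m : ℕ} (M : Market m) {Q : Set ℝ} (hQ : ∀ i, M.quality i ∈ Q) :
    Feasible M Q fun i => Measure.dirac (M.quality i) where
  prob i := inferInstance
  support i := by simp [hQ i]
  bayes B hB := by
    refine Finset.sum_congr rfl fun i _ => ?_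
    rw [← integral_indicator hB, integral_dirac, measureReal_def, Measure.dirac_apply' _ hB, mul_assoc]
    by_cases h : M.quality i ∈ B <;> simp [h]

/-- The mixture of point masses `x k` at `y k` and `x' k` at `y'`. -/
noncomputable def gridLaw (n : ℕ) (x x' y : ℕ → ℝ) (y' : ℝ) : Measure ℝ :=
  ∑ k ∈ Finset.range n, (ENNReal.ofReal (x k) • Measure.dirac (y k) +
    ENNReal.ofReal (x' k) • Measure.dirac y')

lemma integral_gridLaw {n : ℕ} {x x' y : ℕ → ℝ} {y' : ℝ} (hx : ∀ k, 0 ≤ x k) (hx' : ∀ k, 0 ≤ x' k)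
    (f : ℝ → ℝ) :
    ∫ q, f q ∂gridLaw n x x' y y' = ∑ k ∈ Finset.range n, (x k * f (y k) + x' k * f y') := by
  have hi : ∀ (c z : ℝ), Integrable f (ENNReal.ofReal c • Measure.dirac z) := fun c z =>
    (integrable_dirac (by simp)).smul_measure ENNReal.ofReal_ne_top
  rw [gridLaw, integral_finsetSum_measure fun k _ => (hi _ _).add_measure (hi _ _)]
  refine Finset.sum_congr rfl fun k _ => ?_
  rw [integral_add_measure (hi _ _) (hi _ _), integral_smul_measure, integral_smul_measure,
    integral_dirac, integral_dirac, ENNReal.toReal_ofReal (hx k), ENNReal.toReal_ofReal (hx' k),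
    smul_eq_mul, smul_eq_mul]

lemma gridLaw_real {n : ℕ} {x x' y : ℕ → ℝ} {y' : ℝ} (hx : ∀ k, 0 ≤ x k) (hx' : ∀ k, 0 ≤ x' k)
    {B : Set ℝ} (hB : MeasurableSet B) : (gridLaw n x x' y y').real B =
      ∑ k ∈ Finset.range n, (x k * B.indicator 1 (y k) + x' k * B.indicator 1 y') := by
  rw [← integral_gridLaw hx hx', integral_indicator_one hB]

/-- Bayes consistency on `B` replaces the quality by the posterior mean, which is at least `a`
there. This supplies the hypothesis of `exists_pooling` for each cell. -/
lemma Feasible.sum_cell_nonneg {m : ℕ} {M : Market m} {ρ : Fin m → Measure ℝ}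
    (hρ : Feasible M (Icc 0 1) ρ) {B : Set ℝ} (hB : MeasurableSet B) {a : ℝ}
    (ha : ∀ q ∈ B, 0 ≤ q → a ≤ q) :
    0 ≤ ∑ i, M.prior i * (ρ i).real B * (M.quality i - a) := by
  have h : ∀ i, (ρ i).real B * a ≤ ∫ q in B, q ∂(ρ i) := fun i => by
    have := hρ.prob i
    have hs : ∀ᵐ q ∂(ρ i), q ∈ Icc (0 : ℝ) 1 := by rw [ae_iff]; exact hρ.support i
    have hint : Integrable (fun q => q) (ρ i) :=
      .of_bound measurable_id.aestronglyMeasurable 1 (by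
        filter_upwards [hs] with q hq
        rw [norm_eq_abs, abs_of_nonneg hq.1]; exact hq.2)
    calc (ρ i).real B * a = ∫ _ in B, a ∂(ρ i) := by simp
      _ ≤ _ := by
        refine integral_mono_ae (integrable_const _) hint.integrableOn ?_
        filter_upwards [ae_restrict_of_ae hs, ae_restrict_mem hB] with q hq hqB
        exact ha q hqB hq.1
  have : ∑ i, M.prior i * ((ρ i).real B * a) ≤ ∑ i, M.prior i * M.quality i * (ρ i).real B := by
    rw [hρ.bayes B hB]
    exact Finset.sum_le_sum fun i _ => mul_le_mul_of_nonneg_left (h i) (M.prior_mem.1 i)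
  rw [← sub_nonneg, ← Finset.sum_sub_distrib] at this
  refine this.trans_eq (Finset.sum_congr rfl fun i _ => by ring)

/-- Cell `k` holds the posterior means in `[kε, (k+1)ε)`. Its pool is moved to `kε`, and the mass
taken out of the pool is revealed. Since the price falls by at least `ε`, each buyer faces a
critical type no higher than before. -/
lemma exists_grid_adv {m : ℕ} (M : Market m) {ε : ℝ} (h0 : 0 < ε) {n : ℕ} (hε : n * ε = 1)
    {p p' : ℝ} (hp' : p' ∈ priceGrid 2 ε) (hpp : p' + ε ≤ p) {ρ : Fin m → Measure ℝ}
    (hρ : Feasible M (Icc 0 1) ρ) :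
    ∃ ρ', Feasible M (postGrid additive 2 M ε p') ρ' ∧
      ∑ i, M.prior i * ∫ q, M.demand (criticalType additive p q) ∂(ρ i) ≤
        ∑ i, M.prior i * ∫ q, M.demand (criticalType additive p' q) ∂(ρ' i) := by
  set fl : ℝ → ℕ := fun q => ⌊q / ε⌋₊ with hfl
  have hflm : Measurable fl := Nat.measurable_floor.comp (measurable_id.div_const ε)
  have hms : ∀ k, MeasurableSet (fl ⁻¹' {k}) := fun k => hflm (measurableSet_singleton k)
  have hfl_le : ∀ k q, q ∈ fl ⁻¹' {k} → 0 ≤ q → (k : ℝ) * ε ≤ q := by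
    rintro k q rfl hq
    exact (le_div_iff₀ h0).1 (Nat.floor_le (by positivity))
  have hfl_lt : ∀ q, q < (fl q + 1) * ε := fun q => (div_lt_iff₀ h0).1 (Nat.lt_floor_add_one _)
  have hflmem : ∀ i, ∀ᵐ q ∂(ρ i), q ∈ Icc (0 : ℝ) 1 ∧ fl q ∈ Finset.range (n + 1) := fun i => by
    have hs : ∀ᵐ q ∂(ρ i), q ∈ Icc (0 : ℝ) 1 := by rw [ae_iff]; exact hρ.support i
    filter_upwards [hs] with q hq
    refine ⟨hq, Finset.mem_range.2 (Nat.lt_succ_iff.2 (Nat.floor_le_of_le ?_))⟩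
    rw [div_le_iff₀ h0, hε]; exact hq.2
  set w : Fin m → ℕ → ℝ := fun i k => (ρ i).real (fl ⁻¹' {k}) with hw
  have hw0 : ∀ i k, 0 ≤ w i k := fun _ _ => measureReal_nonneg
  have hsum : ∀ i (g : ℕ → ℝ), Integrable (fun q => g (fl q)) (ρ i) ∧
      ∫ q, g (fl q) ∂(ρ i) = ∑ k ∈ Finset.range (n + 1), g k * w i k := fun i g => by
    have := hρ.prob i
    exact integral_comp_of_ae_mem_finset (fun k _ => hms k) ((hflmem i).mono fun _ h => h.2) g
  -- `c k i` is the share of quality `i` in cell `k` that stays pooled.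
  choose c hc0 hc1 hclow hcmean using fun k : ℕ =>
    exists_pooling (fun i => mul_nonneg (M.prior_mem.1 i) (hw0 i k))
      (hρ.sum_cell_nonneg (hms k) (hfl_le k))
  have hx : ∀ i k, 0 ≤ c k i * w i k := fun i k => mul_nonneg (hc0 k i) (hw0 i k)
  have hx' : ∀ i k, 0 ≤ (1 - c k i) * w i k := fun i k =>
    mul_nonneg (sub_nonneg.2 (hc1 k i)) (hw0 i k)
  set ρ' : Fin m → Measure ℝ := fun i => gridLaw (n + 1) (fun k => c k i * w i k)
    (fun k => (1 - c k i) * w i k) (fun k => k * ε) (M.quality i) with hρ'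
  refine ⟨ρ', ⟨fun i => ⟨?_⟩, fun i => ?_, fun B hB => ?_⟩, Finset.sum_le_sum fun i _ =>
    mul_le_mul_of_nonneg_left ?_ (M.prior_mem.1 i)⟩
  · have h := gridLaw_real (n := n + 1) (y := fun k => k * ε) (y' := M.quality i) (hx i) (hx' i)
      MeasurableSet.univ
    have h1 : ∑ k ∈ Finset.range (n + 1), w i k = 1 := by
      have := hρ.prob i
      have h2 := (hsum i fun _ => 1).2
      simpa using h2.symm
    have h2 : (ρ' i).real univ = 1 := by
      refine h.trans (Eq.trans (Finset.sum_congr rfl fun k _ => ?_) h1)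
      simp only [indicator_univ, Pi.one_apply]
      ring
    rw [measureReal_def] at h2
    exact (ENNReal.toReal_eq_one_iff _).1 h2
  · simp only [hρ', gridLaw, Measure.coe_finsetSum, Finset.sum_apply, Finset.sum_eq_zero_iff]
    intro k hk
    simp [mul_mem_postGrid M h0 hε hp' (Nat.lt_succ_iff.1 (Finset.mem_range.1 hk)),
      quality_mem_postGrid M hp' i]
  -- A revealed quality equals its posterior mean and cancels; the pool at `kε` has mean `kε` by
  -- `hcmean`.
  · rw [← sub_eq_zero, ← Finset.sum_sub_distrib]
    have h : ∀ i, M.prior i * M.quality i * (ρ' i).real B - M.prior i * ∫ q in B, q ∂(ρ' i) =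
        ∑ k ∈ Finset.range (n + 1),
          B.indicator 1 ((k : ℝ) * ε) * (M.prior i * w i k * c k i * (M.quality i - k * ε)) := by
      intro i
      rw [← integral_indicator hB, hρ', gridLaw_real (hx i) (hx' i) hB,
        integral_gridLaw (hx i) (hx' i), Finset.mul_sum, Finset.mul_sum, ← Finset.sum_sub_distrib]
      refine Finset.sum_congr rfl fun k _ => ?_
      by_cases h1 : (k : ℝ) * ε ∈ B <;> by_cases h2 : M.quality i ∈ B <;> simp [h1, h2] <;> ring
    simp only [h]
    rw [Finset.sum_comm]
    refine Finset.sum_eq_zero fun k _ => ?_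
    rw [← Finset.mul_sum, hcmean k, mul_zero]
  · set d : ℕ → ℝ := fun k => M.demand (criticalType additive p' (k * ε)) with hd
    calc ∫ q, M.demand (criticalType additive p q) ∂(ρ i) ≤ ∫ q, d (fl q) ∂(ρ i) := by
          refine integral_mono_of_nonneg (.of_forall fun _ => M.demand_nonneg _) (hsum i d).1 ?_
          filter_upwards [hflmem i] with q hq
          refine M.demand_antitone (criticalType_additive_mono ?_)
          have := hfl_lt q
          linarith
      _ = ∑ k ∈ Finset.range (n + 1), d k * w i k := (hsum i d).2
      _ ≤ _ := by
        rw [hρ', integral_gridLaw (hx i) (hx' i)]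
        refine Finset.sum_le_sum fun k _ => ?_
        -- Low qualities are never taken out of the pool; a revealed one exceeds `kε` and so sells
        -- at least as often as the pool.
        rcases le_or_gt (M.quality i) (k * ε) with h | h
        · rw [hclow k i h]
          exact le_of_eq (by simp [hd]; ring)
        · have h3 : d k ≤ M.demand (criticalType additive p' (M.quality i)) :=
            M.demand_antitone (criticalType_additive_mono (by linarith))
          have := mul_le_mul_of_nonneg_left h3 (hx' i k)
          simp only [hd] at this ⊢
          linarith

theorem exists_grid_strategy {m : ℕ} (M : Market m) {ε : ℝ} (h0 : 0 < ε) {n : ℕ} (hε : n * ε = 1)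
    {p : ℝ} (hp : p ∈ Icc (0 : ℝ) 2) {ρ : Fin m → Measure ℝ} (hρ : Feasible M (Icc 0 1) ρ) :
    ∃ p' ∈ priceGrid 2 ε, ∃ ρ', Feasible M (postGrid additive 2 M ε p') ρ' ∧
      rev additive M p ρ ≤ estRev additive M M.demand p' ρ' + 2 * ε := by
  have hfl : (⌊p / ε⌋₊ : ℝ) * ε ≤ p :=
    (le_div_iff₀ h0).1 (Nat.floor_le (div_nonneg hp.1 h0.le))
  have hlt : p < (⌊p / ε⌋₊ + 1) * ε := (div_lt_iff₀ h0).1 (Nat.lt_floor_add_one _)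
  have hn : 1 ≤ n := Nat.one_le_iff_ne_zero.2 (by rintro rfl; simp at hε)
  -- Below `2ε` there may be no grid price lower by `ε`, but there the revenue is itself less than
  -- `2ε`, and any grid strategy will do. Otherwise the new price is `(⌊p / ε⌋ - 1) ε`.
  rcases lt_or_ge ⌊p / ε⌋₊ 2 with h | h
  · have hmem : ε ∈ priceGrid 2 ε := (mem_priceGrid hε).2 ⟨1, le_rfl, by omega, by simp⟩
    refine ⟨ε, hmem, _, feasible_reveal M (quality_mem_postGrid M hmem), ?_⟩
    have h1 : (⌊p / ε⌋₊ : ℝ) ≤ 1 := by exact_mod_cast Nat.lt_succ_iff.1 h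
    have h2 := rev_additive_le hp.1 hρ
    have h3 := estRev_nonneg M M.demand_nonneg h0.le fun i => Measure.dirac (M.quality i)
    nlinarith
  · obtain ⟨j, hj⟩ : ∃ j, ⌊p / ε⌋₊ = j + 1 := ⟨⌊p / ε⌋₊ - 1, by omega⟩
    rw [hj] at h hlt hfl
    push_cast at hfl hlt
    have hjn : j ≤ 2 * n := by
      have : (j : ℝ) * ε ≤ (2 * n : ℕ) * ε := by push_cast; have := hp.2; nlinarith
      exact_mod_cast le_of_mul_le_mul_right this h0
    have hmem : (j : ℝ) * ε ∈ priceGrid 2 ε := (mem_priceGrid hε).2 ⟨j, by omega, hjn, rfl⟩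
    obtain ⟨ρ', hρ', hle⟩ := exists_grid_adv M h0 hε hmem (p := p) (by linarith) hρ
    refine ⟨_, hmem, ρ', hρ', ?_⟩
    rw [rev_additive, estRev, estRev]
    have h1 := hρ.sum_prior_integral_le_one (f := fun q => M.demand (criticalType additive p q))
      (fun _ => M.demand_nonneg _) fun _ => M.demand_le_one _
    set X := ∑ i, M.prior i * ∫ q, M.demand (criticalType additive p q) ∂(ρ i)
    set Y := ∑ i, M.prior i * ∫ q, M.demand (criticalType additive (j * ε) q) ∂(ρ' i)
    calc p * X = j * ε * X + (p - j * ε) * X := by ring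
      _ ≤ j * ε * Y + (p - j * ε) * 1 := by
        gcongr
        nlinarith
      _ ≤ _ := by linarith

/-! ### Concentration of empirical averages at randomly visited points -/

/-- For a centered variable the linear term vanishes in the mean, which leaves a sub-Gaussian bound
on the moment generating function. -/
lemma exp_le_self_add_exp_sq (y : ℝ) : exp y ≤ y + exp (y ^ 2) := by
  have h2 := add_one_le_exp (y ^ 2)
  rcases le_or_gt |y| 1 with h | h
  · have h1 := (abs_le.1 (abs_exp_sub_one_sub_id_le h)).2
    linarith
  · rcases lt_abs.1 h with h | h
    · have : exp y ≤ exp (y ^ 2) := exp_le_exp.2 (by nlinarith)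
      linarith
    · have : exp y ≤ 1 := exp_le_one_iff.2 (by linarith)
      nlinarith

lemma bernoulli_exp_le {d : ℝ} (h0 : 0 ≤ d) (h1 : d ≤ 1) (l : ℝ) :
    d * exp (l * (1 - d) - l ^ 2) + (1 - d) * exp (-(l * d) - l ^ 2) ≤ 1 := by
  have key : d * exp (l * (1 - d)) + (1 - d) * exp (-(l * d)) ≤ exp (l ^ 2) := by
    have e1 := exp_le_self_add_exp_sq (l * (1 - d))
    have e2 := exp_le_self_add_exp_sq (-(l * d))
    have e3 : exp ((l * (1 - d)) ^ 2) ≤ exp (l ^ 2) := exp_le_exp.2 (by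
      rw [mul_pow]; exact mul_le_of_le_one_right (sq_nonneg l) (by nlinarith))
    have e4 : exp ((-(l * d)) ^ 2) ≤ exp (l ^ 2) := exp_le_exp.2 (by
      rw [neg_sq, mul_pow]; exact mul_le_of_le_one_right (sq_nonneg l) (by nlinarith))
    calc _ ≤ d * (l * (1 - d) + exp (l ^ 2)) + (1 - d) * (-(l * d) + exp (l ^ 2)) := by
          gcongr
          · linarith
          · linarith
      _ = _ := by ring
  rw [exp_sub, exp_sub, ← mul_div_assoc, ← mul_div_assoc, ← add_div]
  exact div_le_one_of_le₀ key (exp_pos _).le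

section Sampling

variable {Ω' : Type*}

/-- The indicator of a visit of `x` in round `t`. -/
noncomputable def hit (K : ℕ → Ω' → ℝ) (x : ℝ) (t : ℕ) (s : Ω') : ℝ := if K t s = x then 1 else 0

/-- The number of visits of `x` before round `t`. -/
noncomputable def count (K : ℕ → Ω' → ℝ) (x : ℝ) (t : ℕ) (s : Ω') : ℝ :=
  ∑ τ ∈ Finset.range t, hit K x τ s

/-- The sum of the deviations of `a` from `d` over the visits of `x` before round `t`. -/
noncomputable def deviation (K a : ℕ → Ω' → ℝ) (x d : ℝ) (t : ℕ) (s : Ω') : ℝ :=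
  ∑ τ ∈ Finset.range t, hit K x τ s * (a τ s - d)

lemma hit_eq (K : ℕ → Ω' → ℝ) (x : ℝ) (t : ℕ) (s : Ω') : hit K x t s = 0 ∨ hit K x t s = 1 := by
  unfold hit; split_ifs <;> simp

lemma hit_nonneg (K : ℕ → Ω' → ℝ) (x : ℝ) (t : ℕ) (s : Ω') : 0 ≤ hit K x t s := by
  rcases hit_eq K x t s with h | h <;> simp [h]

lemma hit_le_one (K : ℕ → Ω' → ℝ) (x : ℝ) (t : ℕ) (s : Ω') : hit K x t s ≤ 1 := by
  rcases hit_eq K x t s with h | h <;> simp [h]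

lemma count_eq_card (K : ℕ → Ω' → ℝ) (x : ℝ) (t : ℕ) (s : Ω') :
    count K x t s = ((Finset.range t).filter fun τ => K τ s = x).card := by
  simp [count, hit]

lemma count_nonneg (K : ℕ → Ω' → ℝ) (x : ℝ) (t : ℕ) (s : Ω') : 0 ≤ count K x t s :=
  Finset.sum_nonneg fun _ _ => hit_nonneg _ _ _ _

variable [mΩ' : MeasurableSpace Ω']

/-- Whenever the sampled point `K t` is `x`, the outcome `a t ∈ {0, 1}` has the conditional mean
`D x`, given the past and the event `K t = x`. -/
structure Samples (P : Measure Ω') (ℱ : Filtration ℕ mΩ') (T : ℕ) (K a : ℕ → Ω' → ℝ)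
    (D : ℝ → ℝ) : Prop where
  meas_point : ∀ t < T, Measurable[ℱ (t + 1)] (K t)
  meas_outcome : ∀ t < T, Measurable[ℱ (t + 1)] (a t)
  outcome : ∀ t s, a t s = 0 ∨ a t s = 1
  mean_nonneg : ∀ x, 0 ≤ D x
  mean_le_one : ∀ x, D x ≤ 1
  mean : ∀ t < T, ∀ x, ∀ Z : Ω' → ℝ, Measurable[ℱ t] Z → (∃ C, ∀ s, |Z s| ≤ C) →
    ∫ s, Z s * hit K x t s * a t s ∂P = D x * ∫ s, Z s * hit K x t s ∂P

variable {P : Measure Ω'} {ℱ : Filtration ℕ mΩ'} {T : ℕ} {K a : ℕ → Ω' → ℝ} {D : ℝ → ℝ}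

lemma Samples.measurable_hit (h : Samples P ℱ T K a D) (x : ℝ) {t τ : ℕ} (hτ : τ < t)
    (ht : t ≤ T) : Measurable[ℱ t] (hit K x τ) :=
  (show Measurable[ℱ (τ + 1)] (hit K x τ) from
    Measurable.ite (m := ℱ (τ + 1)) (h.meas_point τ (by omega) (measurableSet_singleton x))
      measurable_const measurable_const).mono
    (ℱ.mono (by omega)) le_rfl

lemma Samples.measurable_count (h : Samples P ℱ T K a D) (x : ℝ) {t : ℕ} (ht : t ≤ T) :
    Measurable[ℱ t] (count K x t) :=
  Finset.measurable_fun_sum (m := ℱ t) _ fun _ hτ => h.measurable_hit x (Finset.mem_range.1 hτ) ht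

lemma Samples.measurable_deviation (h : Samples P ℱ T K a D) (x d : ℝ) {t : ℕ} (ht : t ≤ T) :
    Measurable[ℱ t] (deviation K a x d t) :=
  Finset.measurable_fun_sum (m := ℱ t) _ fun τ hτ => by
    have hτ := Finset.mem_range.1 hτ
    exact (h.measurable_hit x hτ ht).mul
      (((h.meas_outcome τ (by omega)).mono (ℱ.mono (by omega)) le_rfl).sub_const d)

lemma Samples.abs_deviation_le (h : Samples P ℱ T K a D) (x : ℝ) (t : ℕ) (s : Ω') :
    |deviation K a x (D x) t s| ≤ t := by
  calc _ ≤ ∑ τ ∈ Finset.range t, |hit K x τ s * (a τ s - D x)| := Finset.abs_sum_le_sum_abs _ _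
    _ ≤ ∑ τ ∈ Finset.range t, 1 := Finset.sum_le_sum fun τ _ => by
        have h0 := h.mean_nonneg x
        have h1 := h.mean_le_one x
        rw [abs_le]
        rcases hit_eq K x τ s with h2 | h2 <;> rcases h.outcome τ s with h3 | h3 <;>
          simp only [h2, h3] <;> constructor <;> linarith
    _ = t := by simp

/-- The exponential supermartingale of the deviations. -/
noncomputable def expDev (K a : ℕ → Ω' → ℝ) (x d l : ℝ) (t : ℕ) (s : Ω') : ℝ :=
  exp (l * deviation K a x d t s - l ^ 2 * count K x t s)

lemma Samples.measurable_expDev (h : Samples P ℱ T K a D) (x d l : ℝ) {t : ℕ} (ht : t ≤ T) :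
    Measurable[ℱ t] (expDev K a x d l t) :=
  measurable_exp.comp (((h.measurable_deviation x d ht).const_mul l).sub
    ((h.measurable_count x ht).const_mul (l ^ 2)))

lemma Samples.expDev_le (h : Samples P ℱ T K a D) (x l : ℝ) (t : ℕ) (s : Ω') :
    |expDev K a x (D x) l t s| ≤ exp (|l| * t) := by
  rw [expDev, abs_of_pos (exp_pos _), exp_le_exp]
  have h1 : l * deviation K a x (D x) t s ≤ |l| * t :=
    (le_abs_self _).trans (by rw [abs_mul]; gcongr; exact h.abs_deviation_le x t s)
  have h2 := mul_nonneg (sq_nonneg l) (count_nonneg K x t s)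
  linarith

/-- A round that misses `x` leaves `expDev` unchanged. A visit multiplies it by a factor whose
conditional mean is at most `1`, by `bernoulli_exp_le`. -/
lemma Samples.integral_expDev_le [IsProbabilityMeasure P] (h : Samples P ℱ T K a D) (x l : ℝ)
    {t : ℕ} (ht : t ≤ T) : ∫ s, expDev K a x (D x) l t s ∂P ≤ 1 := by
  induction t with
  | zero => simp [expDev, deviation, count]
  | succ t ih =>
    have htT : t < T := ht
    have ih := ih htT.le
    set Z := expDev K a x (D x) l t with hZ
    have hZm : Measurable[ℱ t] Z := h.measurable_expDev x (D x) l htT.le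
    have hZm' : Measurable Z := hZm.mono (ℱ.le t) le_rfl
    have hhm : Measurable (hit K x t) :=
      (h.measurable_hit x (Nat.lt_succ_self t) ht).mono (ℱ.le _) le_rfl
    have ham : Measurable (a t) := (h.meas_outcome t htT).mono (ℱ.le _) le_rfl
    have hb := h.expDev_le x l t
    have i0 : Integrable Z P := .of_bound hZm'.aestronglyMeasurable _ (.of_forall hb)
    have i1 : Integrable (fun s => Z s * hit K x t s) P := by
      refine i0.mono (hZm'.mul hhm).aestronglyMeasurable (.of_forall fun s => ?_)
      rcases hit_eq K x t s with h2 | h2 <;> simp [h2]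
    have i2 : Integrable (fun s => Z s * hit K x t s * a t s) P := by
      refine i0.mono ((hZm'.mul hhm).mul ham).aestronglyMeasurable (.of_forall fun s => ?_)
      rcases hit_eq K x t s with h2 | h2 <;> rcases h.outcome t s with h3 | h3 <;> simp [h2, h3]
    set c := exp (l * (1 - D x) - l ^ 2)
    set d := exp (-(l * D x) - l ^ 2)
    -- As the hit and the outcome are `0` or `1`, the exponential factor is linear in the hit and in
    -- the product of the two, so `mean` evaluates its integral.
    have hstep : ∀ s, expDev K a x (D x) l (t + 1) s =
        Z s + (c - d) * (Z s * hit K x t s * a t s) + (d - 1) * (Z s * hit K x t s) := by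
      intro s
      have : expDev K a x (D x) l (t + 1) s =
          Z s * exp (l * (hit K x t s * (a t s - D x)) - l ^ 2 * hit K x t s) := by
        rw [hZ, expDev, expDev, ← exp_add, deviation, count, Finset.sum_range_succ,
          Finset.sum_range_succ, deviation, count]
        congr 1
        ring
      rw [this]
      rcases hit_eq K x t s with h2 | h2 <;> rcases h.outcome t s with h3 | h3 <;>
        simp [h2, h3, c, d] <;> ring
    simp only [hstep]
    rw [integral_add (f := fun s => Z s + (c - d) * (Z s * hit K x t s * a t s))
      (i0.add (i2.const_mul _)) (i1.const_mul _), integral_add i0 (i2.const_mul _),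
      integral_const_mul, integral_const_mul, h.mean t htT x Z hZm ⟨_, hb⟩]
    have hpos : 0 ≤ ∫ s, Z s * hit K x t s ∂P :=
      integral_nonneg fun s => mul_nonneg (exp_pos _).le (hit_nonneg _ _ _ _)
    have := bernoulli_exp_le (h.mean_nonneg x) (h.mean_le_one x) l
    have : (D x * c + (1 - D x) * d) * ∫ s, Z s * hit K x t s ∂P ≤
        1 * ∫ s, Z s * hit K x t s ∂P := mul_le_mul_of_nonneg_right this hpos
    linarith

/-- The number of visits is random, so the best `l` is not known in advance. A union bound over its
possible values `k` and both signs of `l`, with Markov at level `T ^ 4` for each, costs `2T / T ^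
4`. -/
lemma Samples.measure_deviation_le [IsProbabilityMeasure P] (h : Samples P ℱ T K a D)
    (hT : 2 ≤ T) (x : ℝ) {t : ℕ} (ht : t ≤ T) :
    P.real {s | 0 < count K x t s ∧
      4 * √(count K x t s * log T) < |deviation K a x (D x) t s|} ≤ 2 / (T : ℝ) ^ 3 := by
  have hT0 : (0 : ℝ) < T := by positivity
  have hlog : 0 < log T := log_pos (by exact_mod_cast hT)
  have markov : ∀ l, P.real {s | (T : ℝ) ^ 4 ≤ expDev K a x (D x) l t s} ≤ 1 / (T : ℝ) ^ 4 := by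
    intro l
    have h1 := mul_meas_ge_le_integral_of_nonneg (μ := P) (f := expDev K a x (D x) l t)
      (.of_forall fun s => (exp_pos _).le)
      (.of_bound ((h.measurable_expDev x (D x) l ht).mono (ℱ.le t) le_rfl).aestronglyMeasurable _
        (.of_forall (h.expDev_le x l t))) ((T : ℝ) ^ 4)
    rw [le_div_iff₀ (by positivity), mul_comm]
    exact h1.trans (h.integral_expDev_le x l ht)
  -- This maximizes `l * y - l ^ 2 * k` at `y = 4 * √(k * log T)`; the maximum is `8 log T - 4 log
  -- T`.
  set l : ℕ → ℝ := fun k => 2 * √(log T / k) with hl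
  have hsub : {s | 0 < count K x t s ∧
      4 * √(count K x t s * log T) < |deviation K a x (D x) t s|} ⊆
      ⋃ k ∈ Finset.Icc 1 T, ({s | (T : ℝ) ^ 4 ≤ expDev K a x (D x) (l k) t s} ∪
        {s | (T : ℝ) ^ 4 ≤ expDev K a x (D x) (-l k) t s}) := by
    rintro s ⟨hpos, hdev⟩
    obtain ⟨k, hk⟩ : ∃ k, k = ((Finset.range t).filter fun τ => K τ s = x).card := ⟨_, rfl⟩
    have hc : count K x t s = k := by rw [hk]; exact count_eq_card K x t s
    have hkT : k ≤ T := by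
      rw [hk]; exact (Finset.card_filter_le _ _).trans (by simpa using ht)
    rw [hc] at hpos hdev
    have hk1 : 1 ≤ k := by exact_mod_cast hpos
    simp only [mem_iUnion]
    refine ⟨k, Finset.mem_Icc.2 ⟨hk1, hkT⟩, ?_⟩
    have hl0 : 0 < l k := by positivity
    have hlk : l k ^ 2 * k = 4 * log T := by
      rw [hl, mul_pow, sq_sqrt (by positivity)]; field_simp; norm_num
    have hll : l k * (4 * √(k * log T)) = 8 * log T := by
      have : √(log T / k) * √(k * log T) = log T := by
        rw [← sqrt_mul (by positivity), show log T / k * (k * log T) = log T ^ 2 by field_simp,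
          sqrt_sq hlog.le]
      calc _ = 8 * (√(log T / k) * √(k * log T)) := by rw [hl]; ring
        _ = _ := by rw [this]
    have hmain : ∀ y, 4 * √(k * log T) < y → (T : ℝ) ^ 4 ≤ exp (l k * y - l k ^ 2 * k) := by
      intro y hy
      have : (T : ℝ) ^ 4 = exp (4 * log T) := by
        rw [← exp_log hT0, ← exp_nat_mul, exp_log hT0]; norm_num
      rw [this, exp_le_exp, hlk]
      have := mul_le_mul_of_nonneg_left hy.le hl0.le
      linarith
    rcases lt_abs.1 hdev with h1 | h1
    · left
      rw [mem_ofPred_eq, expDev, hc]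
      exact hmain _ h1
    · right
      rw [mem_ofPred_eq, expDev, hc, neg_sq, neg_mul, ← mul_neg]
      exact hmain _ h1
  calc _ ≤ _ := measureReal_mono hsub (measure_ne_top _ _)
    _ ≤ ∑ k ∈ Finset.Icc 1 T, P.real ({s | (T : ℝ) ^ 4 ≤ expDev K a x (D x) (l k) t s} ∪
        {s | (T : ℝ) ^ 4 ≤ expDev K a x (D x) (-l k) t s}) := measureReal_biUnion_finset_le _ _
    _ ≤ ∑ k ∈ Finset.Icc 1 T, 2 / (T : ℝ) ^ 4 := Finset.sum_le_sum fun k _ =>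
        (measureReal_union_le _ _).trans ((add_le_add (markov _) (markov _)).trans_eq (by ring))
    _ = 2 / (T : ℝ) ^ 3 := by
        rw [Finset.sum_const, Nat.card_Icc, nsmul_eq_mul]
        simp only [Nat.add_sub_cancel]
        field_simp

/-- Some average over the visits of a point of `S` is not close to its mean. -/
def badEvent (K a : ℕ → Ω' → ℝ) (D : ℝ → ℝ) (S : Finset ℝ) (T t : ℕ) : Set Ω' :=
  ⋃ x ∈ S, {s | 0 < count K x t s ∧
    4 * √(count K x t s * log T) < |deviation K a x (D x) t s|}

lemma Samples.measurableSet_badEvent (h : Samples P ℱ T K a D) (S : Finset ℝ) {t : ℕ}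
    (ht : t ≤ T) : MeasurableSet (badEvent K a D S T t) := by
  refine Finset.measurableSet_biUnion _ fun x _ => ?_
  have h1 : Measurable (count K x t) := (h.measurable_count x ht).mono (ℱ.le t) le_rfl
  have h2 : Measurable (deviation K a x (D x) t) :=
    (h.measurable_deviation x (D x) ht).mono (ℱ.le t) le_rfl
  exact (measurableSet_lt measurable_const h1).inter
    (measurableSet_lt ((h1.mul_const _).sqrt.const_mul _) (by simpa using h2.norm))

lemma Samples.measure_badEvent_le [IsProbabilityMeasure P] (h : Samples P ℱ T K a D)
    (hT : 2 ≤ T) {S : Finset ℝ} (hS : S.card ≤ T) {t : ℕ} (ht : t ≤ T) :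
    P.real (badEvent K a D S T t) ≤ 2 / (T : ℝ) ^ 2 := by
  have hT0 : (0 : ℝ) < T := by positivity
  calc _ ≤ ∑ x ∈ S, _ := measureReal_biUnion_finset_le _ _
    _ ≤ ∑ x ∈ S, 2 / (T : ℝ) ^ 3 := Finset.sum_le_sum fun x _ => h.measure_deviation_le hT x ht
    _ = S.card * (2 / (T : ℝ) ^ 3) := by rw [Finset.sum_const, nsmul_eq_mul]
    _ ≤ T * (2 / (T : ℝ) ^ 3) := by gcongr
    _ = _ := by field_simp

end Sampling

/-- Each visit of a point is charged against the growth of the square root of the number of its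
visits. -/
lemma sum_hit_div_sqrt_count_le {Ω' : Type*} (K : ℕ → Ω' → ℝ) (S : Finset ℝ) (n T : ℕ)
    (s : Ω') (h1 : ∀ t, n ≤ t → ∀ x ∈ S, 1 ≤ count K x t s) :
    ∑ t ∈ Finset.Ico n T, ∑ x ∈ S, hit K x t s / √(count K x t s) ≤ 3 * √(S.card * T) := by
  have hstep : ∀ t, n ≤ t → ∀ x ∈ S, hit K x t s / √(count K x t s) ≤
      3 * (√(count K x (t + 1) s) - √(count K x t s)) := by
    intro t ht x hx
    have hc := h1 t ht x hx
    have hsucc : count K x (t + 1) s = count K x t s + hit K x t s := Finset.sum_range_succ _ _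
    rcases hit_eq K x t s with h | h
    · simp [hsucc, h]
    · rw [hsucc, h]
      set N := count K x t s
      have hs : 1 ≤ √N := one_le_sqrt.2 hc
      have ha := sq_sqrt (show 0 ≤ N by linarith)
      have hb := sq_sqrt (show 0 ≤ N + 1 by linarith)
      -- Hence `√(N + 1) - √N = 1 / (√(N + 1) + √N) ≥ 1 / (3 √N)`, the source of the constant `3`.
      have hle : √(N + 1) ≤ 2 * √N := by
        rw [sqrt_le_left (by positivity)]; nlinarith
      have hge := sqrt_le_sqrt (show N ≤ N + 1 by linarith)
      rw [div_le_iff₀ (by linarith)]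
      nlinarith
  -- Cauchy–Schwarz; the counts sum to at most `T` because a round visits at most one point.
  have hsq : ∑ x ∈ S, √(count K x T s) ≤ √(S.card * T) := by
    refine le_sqrt_of_sq_le ?_
    calc (∑ x ∈ S, √(count K x T s)) ^ 2 ≤ S.card * ∑ x ∈ S, √(count K x T s) ^ 2 :=
          sq_sum_le_card_mul_sum_sq
      _ = S.card * ∑ x ∈ S, count K x T s := by
          congr 1; exact Finset.sum_congr rfl fun x _ => sq_sqrt (count_nonneg _ _ _ _)
      _ ≤ S.card * T := by
          gcongr
          simp only [count]
          rw [Finset.sum_comm]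
          calc _ ≤ ∑ τ ∈ Finset.range T, (1 : ℝ) := Finset.sum_le_sum fun τ _ => by
                simp only [hit, Finset.sum_ite_eq]; split_ifs <;> norm_num
            _ = T := by simp
  rcases le_total n T with hn | hn
  · calc _ ≤ ∑ t ∈ Finset.Ico n T, ∑ x ∈ S, 3 * (√(count K x (t + 1) s) - √(count K x t s)) :=
          Finset.sum_le_sum fun t ht => Finset.sum_le_sum fun x hx =>
            hstep t (Finset.mem_Ico.1 ht).1 x hx
      _ = ∑ x ∈ S, 3 * (√(count K x T s) - √(count K x n s)) := by
          rw [Finset.sum_comm]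
          refine Finset.sum_congr rfl fun x _ => ?_
          rw [← Finset.mul_sum, Finset.sum_Ico_sub (fun t => √(count K x t s)) hn]
      _ ≤ 3 * ∑ x ∈ S, √(count K x T s) := by
          rw [Finset.mul_sum]
          exact Finset.sum_le_sum fun x _ => by have := sqrt_nonneg (count K x n s); linarith
      _ ≤ _ := by gcongr
  · rw [Finset.Ico_eq_empty_of_le hn, Finset.sum_empty]; positivity

/-! ### Conditional laws along a run -/

/-- The probability that the critical type is `x`, at the price `p` and the strategy `ρ`. -/
noncomputable def pointLaw {m : ℕ} (M : Market m) (p : ℝ) (ρ : Fin m → Measure ℝ) (x : ℝ) : ℝ :=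
  ∑ i, M.prior i * (ρ i).real {q | criticalType additive p q = x}

lemma pointLaw_nonneg {m : ℕ} (M : Market m) (p : ℝ) (ρ : Fin m → Measure ℝ) (x : ℝ) :
    0 ≤ pointLaw M p ρ x :=
  Finset.sum_nonneg fun i _ => mul_nonneg (M.prior_mem.1 i) measureReal_nonneg

lemma measurableSet_criticalType (p x : ℝ) :
    MeasurableSet {q | criticalType additive p q = x} :=
  (measurable_criticalType_additive.comp measurable_prodMk_left) (measurableSet_singleton x)

/-- Support in `𝒬_p` makes the critical type `𝒮`-valued, so only the values of `D` on `𝒮` matter and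
`D` need not be measurable. -/
lemma estRev_eq_sum {m : ℕ} {M : Market m} {ε p : ℝ} {ρ : Fin m → Measure ℝ}
    (hρ : Feasible M (postGrid additive 2 M ε p) ρ) (D : ℝ → ℝ) :
    estRev additive M D p ρ = p * ∑ x ∈ typeGrid additive 2 M ε, D x * pointLaw M p ρ x := by
  rw [estRev]
  congr 1
  have h : ∀ i, ∫ q, D (criticalType additive p q) ∂(ρ i) = ∑ x ∈ typeGrid additive 2 M ε,
      D x * (ρ i).real {q | criticalType additive p q = x} := fun i => by
    have := hρ.prob i
    have hs : ∀ᵐ q ∂(ρ i), q ∈ postGrid additive 2 M ε p := by rw [ae_iff]; exact hρ.support i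
    exact (integral_comp_of_ae_mem_finset (fun x _ => measurableSet_criticalType p x)
      (hs.mono fun q hq => hq.2) D).2
  simp only [h, pointLaw, Finset.mul_sum]
  rw [Finset.sum_comm]
  exact Finset.sum_congr rfl fun x _ => Finset.sum_congr rfl fun i _ => by ring

section Run

variable {m : ℕ} {M : Market m} {ε : ℝ} {T : ℕ} {Ω' : Type*} [mΩ' : MeasurableSpace Ω']
  {P : Measure Ω'} {ℱ : Filtration ℕ mΩ'} {price : ℕ → Ω' → ℝ}
  {adv : ℕ → Ω' → Fin m → Measure ℝ} {θ : ℕ → Ω' → ℝ} {ω : ℕ → Ω' → Fin m} {q : ℕ → Ω' → ℝ}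

lemma IsRun.isProbabilityMeasure_adv (h : IsRun additive 2 M ε T P ℱ price adv θ ω q) {t : ℕ}
    (ht : t < T) (s : Ω') (i : Fin m) : IsProbabilityMeasure (adv t s i) := by
  rcases lt_or_ge t (typeGrid additive 2 M ε).card with h1 | h1
  · obtain ⟨e, he⟩ := h.init s
    rw [(he t ht h1).2.1 i]
    infer_instance
  · exact (h.main s t ht h1).1.2.prob i

lemma IsRun.measurable_adv_real (h : IsRun additive 2 M ε T P ℱ price adv θ ω q) {t : ℕ}
    (ht : t < T) (i : Fin m) {B : Set ℝ} (hB : MeasurableSet B) :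
    Measurable[ℱ t] fun s => (adv t s i).real B :=
  ((Measure.measurable_coe hB).comp (h.adv_meas t ht i)).ennreal_toReal

/-- The conditional law in integrated form, tested against a bounded function of the past and summed
over the unobserved quality. -/
lemma IsRun.integral_indicator_eq [IsProbabilityMeasure P]
    (h : IsRun additive 2 M ε T P ℱ price adv θ ω q) {t : ℕ} (ht : t < T) {Z : Ω' → ℝ}
    (hZ : Measurable[ℱ t] Z) {C : ℝ} (hC : ∀ s, |Z s| ≤ C) {A B : Set ℝ} (hA : MeasurableSet A)
    (hB : MeasurableSet B) :
    ∫ s, Z s * ((θ t ⁻¹' A).indicator 1 s * (q t ⁻¹' B).indicator 1 s) ∂P =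
      M.typeLaw.real A * ∫ s, Z s * ∑ i, M.prior i * (adv t s i).real B ∂P := by
  have hle := ℱ.le t
  have hle' := ℱ.le (t + 1)
  have hθ : Measurable (θ t) := (h.type_meas t ht).mono hle' le_rfl
  have hω : Measurable (ω t) := (h.quality_meas t ht).mono hle' le_rfl
  have hq : Measurable (q t) := (h.post_meas t ht).mono hle' le_rfl
  have hZ' : Measurable Z := hZ.mono hle le_rfl
  set E : Fin m → Set Ω' := fun i => θ t ⁻¹' A ∩ ω t ⁻¹' {i} ∩ q t ⁻¹' B with hE
  have hEm : ∀ i, MeasurableSet (E i) := fun i =>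
    ((hθ hA).inter (hω (measurableSet_singleton i))).inter (hq hB)
  have i1 : ∀ i, Integrable ((E i).indicator fun _ => (1 : ℝ)) P := fun i =>
    (integrable_const _).indicator (hEm i)
  have i2 : ∀ i, Integrable (fun s => Z s * (E i).indicator (fun _ => (1 : ℝ)) s) P := fun i =>
    (i1 i).bdd_mul hZ'.aestronglyMeasurable (.of_forall hC)
  have i3 : ∀ i, Integrable (fun s => Z s * (M.typeLaw.real A * M.prior i * (adv t s i).real B)) P :=
    fun i => by
      refine Integrable.bdd_mul (c := C) (.of_bound
        (((h.measurable_adv_real ht i hB).mono hle le_rfl).const_mul _).aestronglyMeasurable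
        |M.typeLaw.real A * M.prior i| (.of_forall fun s => ?_))
        hZ'.aestronglyMeasurable (.of_forall hC)
      have := h.isProbabilityMeasure_adv ht s i
      rw [norm_mul, norm_eq_abs, norm_of_nonneg measureReal_nonneg]
      exact mul_le_of_le_one_right (abs_nonneg _) measureReal_le_one
  have hi : ∀ i, ∫ s, Z s * (E i).indicator (fun _ => (1 : ℝ)) s ∂P =
      ∫ s, Z s * (M.typeLaw.real A * M.prior i * (adv t s i).real B) ∂P := fun i => by
    rw [← integral_condExp hle]
    refine integral_congr_ae ?_
    filter_upwards [condExp_mul_of_stronglyMeasurable_left (m := ℱ t) (μ := P)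
      hZ.stronglyMeasurable (i2 i) (i1 i), h.law t ht A B hA hB i] with s h1 h2
    refine h1.trans ?_
    rw [Pi.mul_apply, h2]
  have hsum : ∀ s, Z s * ((θ t ⁻¹' A).indicator 1 s * (q t ⁻¹' B).indicator 1 s) =
      ∑ i, Z s * (E i).indicator (fun _ => (1 : ℝ)) s := fun s => by
    rw [← Finset.mul_sum, Finset.sum_eq_single_of_mem (ω t s) (Finset.mem_univ _)]
    · by_cases h1 : θ t s ∈ A <;> by_cases h2 : q t s ∈ B <;> simp [hE, h1, h2]
    · intro i _ hne
      exact indicator_of_notMem (fun hs => hne hs.1.2.symm) _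
  simp only [hsum]
  rw [integral_finsetSum _ fun i _ => i2 i, Finset.sum_congr rfl fun i _ => hi i,
    ← integral_finsetSum _ fun i _ => i3 i, ← integral_const_mul]
  refine integral_congr_ae (.of_forall fun s => ?_)
  simp only [Finset.mul_sum]
  exact Finset.sum_congr rfl fun i _ => by ring

lemma IsRun.ae_type_mem [IsProbabilityMeasure P] (h : IsRun additive 2 M ε T P ℱ price adv θ ω q)
    {t : ℕ} (ht : t < T) : ∀ᵐ s ∂P, θ t s ∈ Ico (0 : ℝ) 1 := by
  have h1 := h.integral_indicator_eq ht (Z := fun _ => 1) measurable_const (C := 1) (by simp)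
    (A := (Ico 0 1)ᶜ) measurableSet_Ico.compl MeasurableSet.univ
  have hm : MeasurableSet (θ t ⁻¹' (Ico 0 1)ᶜ) :=
    (h.type_meas t ht).mono (ℱ.le _) le_rfl measurableSet_Ico.compl
  simp only [one_mul, preimage_univ, indicator_univ, Pi.one_apply, mul_one, measureReal_def,
    M.typeLaw_compl_Ico, ENNReal.toReal_zero, zero_mul] at h1
  change ∫ s, (θ t ⁻¹' (Ico 0 1)ᶜ).indicator (1 : Ω' → ℝ) s ∂P = 0 at h1
  rw [integral_indicator_one hm, measureReal_eq_zero_iff] at h1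
  exact h1

lemma IsRun.ae_post_eq [IsProbabilityMeasure P] (h : IsRun additive 2 M ε T P ℱ price adv θ ω q)
    {t : ℕ} (ht : t < T) (htc : t < (typeGrid additive 2 M ε).card) :
    ∀ᵐ s ∂P, q t s = ∑ j, M.prior j * M.quality j := by
  set μ := ∑ j, M.prior j * M.quality j
  have h1 := h.integral_indicator_eq ht (Z := fun _ => 1) measurable_const (C := 1) (by simp)
    MeasurableSet.univ (measurableSet_singleton μ).compl
  have hm : MeasurableSet (q t ⁻¹' {μ}ᶜ) :=
    (h.post_meas t ht).mono (ℱ.le _) le_rfl (measurableSet_singleton μ).compl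
  have h0 : ∀ s i, (adv t s i).real {μ}ᶜ = 0 := fun s i => by
    obtain ⟨e, he⟩ := h.init s
    rw [(he t ht htc).2.1 i]
    change (Measure.dirac μ).real {μ}ᶜ = 0
    simp [measureReal_def]
  simp only [one_mul, preimage_univ, indicator_univ, Pi.one_apply, h0, mul_zero,
    Finset.sum_const_zero, integral_zero] at h1
  change ∫ s, (q t ⁻¹' {μ}ᶜ).indicator (1 : Ω' → ℝ) s ∂P = 0 at h1
  rw [integral_indicator_one hm, measureReal_eq_zero_iff] at h1
  exact h1

/-- The critical type of the realized posterior mean. -/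
noncomputable def point (price q : ℕ → Ω' → ℝ) (t : ℕ) (s : Ω') : ℝ :=
  criticalType additive (price t s) (q t s)

/-- The realized purchase decision. -/
noncomputable def outcome (price q θ : ℕ → Ω' → ℝ) (t : ℕ) (s : Ω') : ℝ :=
  purchase additive (price t s) (q t s) (θ t s)

/-- The price of a main round has finitely many values. Splitting by its value replaces a set that
depends on the random price by fixed Borel sets, to which `law` applies. -/
lemma IsRun.pointLaw_eq (h : IsRun additive 2 M ε T P ℱ price adv θ ω q) {t : ℕ} (ht : t < T)
    (htc : (typeGrid additive 2 M ε).card ≤ t) (x : ℝ) (s : Ω') :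
    pointLaw M (price t s) (adv t s) x = ∑ p ∈ priceGrid 2 ε, (if price t s = p then 1 else 0) *
      ∑ i, M.prior i * (adv t s i).real {q | criticalType additive p q = x} := by
  simp only [ite_mul, one_mul, zero_mul]
  rw [Finset.sum_ite_eq, if_pos (h.main s t ht htc).1.1, pointLaw]

lemma IsRun.measurable_priceIndicator (h : IsRun additive 2 M ε T P ℱ price adv θ ω q) {t : ℕ}
    (ht : t < T) (p : ℝ) : Measurable[ℱ t] fun s => if price t s = p then (1 : ℝ) else 0 :=
  Measurable.ite (m := ℱ t) (h.price_meas t ht (measurableSet_singleton p)) measurable_const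
    measurable_const

lemma IsRun.measurable_pointLaw (h : IsRun additive 2 M ε T P ℱ price adv θ ω q) {t : ℕ}
    (ht : t < T) (htc : (typeGrid additive 2 M ε).card ≤ t) (x : ℝ) :
    Measurable[ℱ t] fun s => pointLaw M (price t s) (adv t s) x := by
  simp only [h.pointLaw_eq ht htc]
  refine Finset.measurable_fun_sum (m := ℱ t) _ fun p _ =>
    (h.measurable_priceIndicator ht p).mul (Finset.measurable_fun_sum (m := ℱ t) _ fun i _ =>
      (h.measurable_adv_real ht i (measurableSet_criticalType p x)).const_mul _)

lemma IsRun.pointLaw_le_one (h : IsRun additive 2 M ε T P ℱ price adv θ ω q) {t : ℕ}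
    (ht : t < T) (x : ℝ) (s : Ω') : pointLaw M (price t s) (adv t s) x ≤ 1 :=
  sum_prior_mul_le M fun i =>
    have := h.isProbabilityMeasure_adv ht s i
    measureReal_le_one

/-- In the main rounds the critical type has the law `pointLaw`, and is independent of the type. -/
lemma IsRun.integral_hit [IsProbabilityMeasure P] (h : IsRun additive 2 M ε T P ℱ price adv θ ω q)
    {t : ℕ} (ht : t < T) (htc : (typeGrid additive 2 M ε).card ≤ t) {Z : Ω' → ℝ}
    (hZ : Measurable[ℱ t] Z) {C : ℝ} (hC : ∀ s, |Z s| ≤ C) {A : Set ℝ} (hA : MeasurableSet A)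
    (x : ℝ) :
    ∫ s, Z s * hit (point price q) x t s * (θ t ⁻¹' A).indicator 1 s ∂P =
      M.typeLaw.real A * ∫ s, Z s * pointLaw M (price t s) (adv t s) x ∂P := by
  have hle := ℱ.le t
  set B : ℝ → Set ℝ := fun p => {q | criticalType additive p q = x} with hBdef
  have hB : ∀ p, MeasurableSet (B p) := fun p => measurableSet_criticalType p x
  set Y : ℝ → Ω' → ℝ := fun p s => Z s * if price t s = p then 1 else 0 with hY
  have hYm : ∀ p, Measurable[ℱ t] (Y p) := fun p => hZ.mul (h.measurable_priceIndicator ht p)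
  have hYC : ∀ p s, |Y p s| ≤ C := fun p s => by
    simp only [hY]
    split_ifs
    · simpa using hC s
    · simpa using (abs_nonneg _).trans (hC s)
  have hYi : ∀ p, Integrable (Y p) P := fun p =>
    .of_bound ((hYm p).mono hle le_rfl).aestronglyMeasurable C (.of_forall (hYC p))
  have hθ : MeasurableSet (θ t ⁻¹' A) := (h.type_meas t ht).mono (ℱ.le _) le_rfl hA
  have hq : ∀ p, MeasurableSet (q t ⁻¹' B p) := fun p =>
    (h.post_meas t ht).mono (ℱ.le _) le_rfl (hB p)
  have hl : ∀ s, Z s * hit (point price q) x t s * (θ t ⁻¹' A).indicator 1 s =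
      ∑ p ∈ priceGrid 2 ε,
        Y p s * ((θ t ⁻¹' A).indicator 1 s * (q t ⁻¹' B p).indicator 1 s) := fun s => by
    have hp := (h.main s t ht htc).1.1
    rw [Finset.sum_eq_single_of_mem _ hp fun p _ hne => by simp [hY, hne.symm]]
    by_cases h1 : criticalType additive (price t s) (q t s) = x <;>
      simp [hY, hit, point, hBdef, h1]
  have hr : ∀ s, Z s * pointLaw M (price t s) (adv t s) x =
      ∑ p ∈ priceGrid 2 ε, Y p s * ∑ i, M.prior i * (adv t s i).real (B p) := fun s => by
    rw [h.pointLaw_eq ht htc, Finset.mul_sum]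
    exact Finset.sum_congr rfl fun p _ => by simp only [hY, hBdef, mul_assoc]
  simp only [hl, hr]
  rw [integral_finsetSum, integral_finsetSum, Finset.mul_sum]
  · exact Finset.sum_congr rfl fun p _ => h.integral_indicator_eq ht (hYm p) (hYC p) hA (hB p)
  · intro p _
    refine (hYi p).mul_bdd (c := 1) (Finset.measurable_fun_sum _ fun i _ =>
      ((h.measurable_adv_real ht i (hB p)).mono hle le_rfl).const_mul _).aestronglyMeasurable
      (.of_forall fun s => ?_)
    rw [norm_of_nonneg (Finset.sum_nonneg fun i _ =>
      mul_nonneg (M.prior_mem.1 i) measureReal_nonneg)]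
    exact sum_prior_mul_le M fun i =>
      have := h.isProbabilityMeasure_adv ht s i
      measureReal_le_one
  · intro p _
    refine (hYi p).mul_bdd (c := 1) ((measurable_one.indicator hθ).mul
      (measurable_one.indicator (hq p))).aestronglyMeasurable (.of_forall fun s => ?_)
    by_cases h1 : s ∈ θ t ⁻¹' A <;> by_cases h2 : s ∈ q t ⁻¹' B p <;> simp [h1, h2]

lemma IsRun.samples [IsProbabilityMeasure P] (h : IsRun additive 2 M ε T P ℱ price adv θ ω q) :
    Samples P ℱ T (point price q) (outcome price q θ) M.demand where
  meas_point t ht := measurable_criticalType_additive.comp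
    (((h.price_meas t ht).mono (ℱ.mono (by omega)) le_rfl).prodMk (h.post_meas t ht))
  meas_outcome t ht := Measurable.ite (m := ℱ (t + 1))
    (measurableSet_le ((h.price_meas t ht).mono (ℱ.mono (by omega)) le_rfl)
      ((h.type_meas t ht).add (h.post_meas t ht))) measurable_const measurable_const
  outcome t s := by unfold outcome purchase; split_ifs <;> simp
  mean_nonneg := M.demand_nonneg
  mean_le_one := M.demand_le_one
  mean t ht x Z hZ := by
    rintro ⟨C, hC⟩
    have := M.typeLaw_prob
    have hae : ∫ s, Z s * hit (point price q) x t s * outcome price q θ t s ∂P =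
        ∫ s, Z s * hit (point price q) x t s * (θ t ⁻¹' Ici x).indicator 1 s ∂P := by
      refine integral_congr_ae ?_
      filter_upwards [h.ae_type_mem ht] with s hs
      unfold hit outcome purchase
      split_ifs with h1 h2 h2
      · rw [indicator_of_mem, Pi.one_apply]
        rw [mem_preimage, mem_Ici, ← h1]; exact (le_additive_iff hs).1 h2
      · rw [indicator_of_notMem]
        rw [mem_preimage, mem_Ici, ← h1]; exact fun h3 => h2 ((le_additive_iff hs).2 h3)
      all_goals simp
    rw [hae]
    rcases lt_or_ge t (typeGrid additive 2 M ε).card with htc | htc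
    -- The initial prices need not lie on the grid, but the posterior mean is almost surely
    -- constant. The hit is then determined by the past and joins the test function.
    · set μ := ∑ j, M.prior j * M.quality j
      set Y : Ω' → ℝ := fun s =>
        Z s * if criticalType additive (price t s) μ = x then 1 else 0 with hY
      have hYm : Measurable[ℱ t] Y := hZ.mul (Measurable.ite (m := ℱ t)
        (measurable_criticalType_additive.comp ((h.price_meas t ht).prodMk measurable_const)
          (measurableSet_singleton x)) measurable_const measurable_const)
      have hYC : ∀ s, |Y s| ≤ C := fun s => by
        simp only [hY]
        split_ifs
        · simpa using hC s
        · simpa using (abs_nonneg _).trans (hC s)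
      have hYZ : ∀ᵐ s ∂P, Z s * hit (point price q) x t s = Y s := by
        filter_upwards [h.ae_post_eq ht htc] with s hs
        rw [hit, point, hs]
      have h1 := h.integral_indicator_eq ht hYm hYC (measurableSet_Ici (a := x))
        MeasurableSet.univ
      have h2 : ∀ s, ∑ i, M.prior i * (adv t s i).real univ = 1 := fun s => by
        rw [← M.prior_mem.2]
        refine Finset.sum_congr rfl fun i _ => ?_
        have := h.isProbabilityMeasure_adv ht s i
        simp
      simp only [h2, mul_one, preimage_univ, indicator_univ, Pi.one_apply] at h1
      rw [integral_congr_ae (hYZ.mono fun s hs => by rw [hs] :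
        ∀ᵐ s ∂P, _ = Y s * (θ t ⁻¹' Ici x).indicator 1 s), h1, integral_congr_ae hYZ]
      rfl
    · have h1 := h.integral_hit ht htc hZ hC MeasurableSet.univ x
      simp only [preimage_univ, indicator_univ, Pi.one_apply, mul_one, probReal_univ,
        one_mul] at h1
      rw [h.integral_hit ht htc hZ hC measurableSet_Ici x, h1]
      rfl

/-- After the initial rounds each grid point has been visited. -/
lemma IsRun.ae_one_le_count [IsProbabilityMeasure P]
    (h : IsRun additive 2 M ε T P ℱ price adv θ ω q) (hT : (typeGrid additive 2 M ε).card ≤ T) :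
    ∀ᵐ s ∂P, ∀ t, (typeGrid additive 2 M ε).card ≤ t → ∀ x ∈ typeGrid additive 2 M ε,
      1 ≤ count (point price q) x t s := by
  have h1 : ∀ᵐ s ∂P, ∀ τ < (typeGrid additive 2 M ε).card,
      q τ s = ∑ j, M.prior j * M.quality j := by
    rw [ae_all_iff]
    intro τ
    by_cases hτ : τ < (typeGrid additive 2 M ε).card
    · exact (h.ae_post_eq (hτ.trans_le hT) hτ).mono fun s hs _ => hs
    · exact .of_forall fun s hs => absurd hs hτ
  filter_upwards [h1] with s hs t ht x hx
  obtain ⟨e, he⟩ := h.init s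
  set j := e.symm ⟨x, hx⟩ with hj
  have h2 := (he j (j.2.trans_le hT) j.2).2.2
  have h3 : hit (point price q) x j s = 1 := by
    rw [hit, point, hs j j.2, h2]
    simp [hj]
  rw [← h3]
  exact Finset.single_le_sum (f := fun τ => hit (point price q) x τ s)
    (fun _ _ => hit_nonneg _ _ _ _) (Finset.mem_range.2 (j.2.trans_le ht))

end Run

/-! ### Regret of a round -/

lemma optRev_le {m : ℕ} (M : Market m) : optRev additive 2 M ≤ 2 := by
  refine Real.sSup_le ?_ zero_le_two
  rintro _ ⟨p, hp, ρ, hρ, rfl⟩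
  exact (rev_additive_le hp.1 hρ).trans hp.2

lemma rev_nonneg {m : ℕ} (M : Market m) {p : ℝ} (hp : 0 ≤ p) (ρ : Fin m → Measure ℝ) :
    0 ≤ rev additive M p ρ := by
  rw [rev_additive]; exact estRev_nonneg M M.demand_nonneg hp ρ

/-- Optimism: if the demand function is overestimated, the optimal revenue is at most the estimated
revenue of an optimal solution, up to the discretization error. -/
lemma optRev_le_estRev {m : ℕ} {M : Market m} {ε : ℝ} (h0 : 0 < ε) {n : ℕ} (hε : n * ε = 1)
    {D : ℝ → ℝ} (hD : ∀ x ∈ typeGrid additive 2 M ε, M.demand x ≤ D x) {p : ℝ}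
    {ρ : Fin m → Measure ℝ} (h : IsOptimal additive 2 M ε D p ρ) :
    optRev additive 2 M ≤ estRev additive M D p ρ + 2 * ε := by
  have hmono : ∀ p' ∈ priceGrid 2 ε, ∀ ρ', Feasible M (postGrid additive 2 M ε p') ρ' →
      estRev additive M M.demand p' ρ' ≤ estRev additive M D p' ρ' := fun p' hp' ρ' hρ' => by
    obtain ⟨k, -, -, rfl⟩ := (mem_priceGrid hε).1 hp'
    rw [estRev_eq_sum hρ', estRev_eq_sum hρ']
    refine mul_le_mul_of_nonneg_left (Finset.sum_le_sum fun x hx => ?_) (by positivity)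
    exact mul_le_mul_of_nonneg_right (hD x hx) (pointLaw_nonneg _ _ _ _)
  have hp0 : 0 ≤ p := by
    obtain ⟨k, -, -, rfl⟩ := (mem_priceGrid hε).1 h.1.1
    positivity
  refine Real.sSup_le ?_ ?_
  · rintro _ ⟨p, hp, ρ, hρ, rfl⟩
    obtain ⟨p', hp', ρ', hρ', hle⟩ := exists_grid_strategy M h0 hε hp hρ
    linarith [hmono p' hp' ρ' hρ', h.2 p' hp' ρ' hρ']
  · linarith [hmono _ h.1.1 _ h.1.2, estRev_nonneg M M.demand_nonneg hp0 ρ]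

lemma div_sqrt_count_le_one {Ω' : Type*} (K : ℕ → Ω' → ℝ) (x : ℝ) (t : ℕ) (s : Ω') :
    |1 / √(count K x t s)| ≤ 1 := by
  rw [abs_of_nonneg (by positivity), count_eq_card]
  -- With no visit the quotient is `1 / 0 = 0`.
  rcases Nat.eq_zero_or_pos ((Finset.range t).filter fun τ => K τ s = x).card with h | h
  · rw [h]; simp
  · exact div_le_one_of_le₀ (one_le_sqrt.2 (by exact_mod_cast h)) (sqrt_nonneg _)

/-! ### Accuracy of the confidence bounds -/

section Index

variable {Ω' : Type*} (price q θ : ℕ → Ω' → ℝ)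

lemma card_visits (t : ℕ) (x : ℝ) (s : Ω') :
    ((visits additive (fun τ => price τ s) (fun τ => q τ s) t x).card : ℝ) =
      count (point price q) x t s := by
  rw [count_eq_card]; rfl

lemma sum_visits (t : ℕ) (x d : ℝ) (s : Ω') :
    ∑ τ ∈ visits additive (fun τ => price τ s) (fun τ => q τ s) t x,
      purchase additive (price τ s) (q τ s) (θ τ s) =
    deviation (point price q) (outcome price q θ) x d t s + d * count (point price q) x t s := by
  simp only [visits, deviation, count, Finset.sum_filter, Finset.mul_sum, ← Finset.sum_add_distrib]
  refine Finset.sum_congr rfl fun τ _ => ?_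
  by_cases h : criticalType additive (price τ s) (q τ s) = x <;> simp [hit, point, outcome, h]

variable {price q θ}

/-- In units of `√(log T / N)`, the deviation is at most `4`, the first radius equals `4` and
cancels it from below, and the second lies between `0` and `2` because `1 ≤ N` and `N + 1 ≤ T`. The
sum is `10`. -/
lemma index_bounds {T t : ℕ} (ht : t < T) {x d : ℝ} {s : Ω'}
    (h1 : 1 ≤ count (point price q) x t s)
    (hdev : |deviation (point price q) (outcome price q θ) x d t s| ≤
      4 * √(count (point price q) x t s * log T)) :
    d ≤ index additive T (fun τ => price τ s) (fun τ => q τ s) (fun τ => θ τ s) t x ∧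
      index additive T (fun τ => price τ s) (fun τ => q τ s) (fun τ => θ τ s) t x ≤
        d + 10 * (√(log T) / √(count (point price q) x t s)) := by
  have hNT : count (point price q) x t s + 1 ≤ T := by
    have h : count (point price q) x t s ≤ t := by
      rw [count_eq_card]
      exact_mod_cast (Finset.card_filter_le _ _).trans (Finset.card_range t).le
    have : (t : ℝ) + 1 ≤ T := by exact_mod_cast ht
    linarith
  simp only [index, card_visits, sum_visits price q θ t x d s]
  set N := count (point price q) x t s
  set y := deviation (point price q) (outcome price q θ) x d t s
  have hN : 0 < N := by linarith
  have hlog : 0 ≤ log T := log_nonneg (by linarith)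
  have hdiv : ∀ c, √(N * c) / N = √c / √N := fun c => by
    rw [sqrt_mul hN.le, div_eq_div_iff hN.ne' (sqrt_pos.2 hN).ne', mul_comm (√N) (√c), mul_assoc,
      mul_self_sqrt hN.le]
  have e1 : √(16 * log T / N) = 4 * (√(log T) / √N) := by
    rw [sqrt_div (by positivity), sqrt_mul (by norm_num), show (16 : ℝ) = 4 ^ 2 by norm_num,
      sqrt_sq (by norm_num), mul_div_assoc]
  have e2 : √((1 + N) * log (1 + N)) / N ≤ 2 * (√(log T) / √N) := by
    rw [← hdiv, ← mul_div_assoc]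
    gcongr
    rw [show (2 : ℝ) = √(2 ^ 2) by rw [sqrt_sq (by norm_num)], ← sqrt_mul (by norm_num)]
    apply sqrt_le_sqrt
    have : log (1 + N) ≤ log T := log_le_log (by linarith) (by linarith)
    calc (1 + N) * log (1 + N) ≤ (2 ^ 2 * N) * log T := by
          gcongr
          · exact log_nonneg (by linarith)
          · linarith
      _ = _ := by ring
  have e3 : 0 ≤ √((1 + N) * log (1 + N)) / N := by positivity
  have e4 : |y / N| ≤ 4 * (√(log T) / √N) := by
    rw [abs_div, abs_of_pos hN, ← hdiv, ← mul_div_assoc]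
    gcongr
  rw [add_div, mul_div_cancel_right₀ _ hN.ne', e1]
  have := abs_le.1 e4
  constructor <;> linarith

end Index

/-! ### Regret of a main round and its sum over all rounds -/

section Run

variable {m : ℕ} {M : Market m} {ε : ℝ} {T : ℕ} {Ω' : Type*} [mΩ' : MeasurableSpace Ω']
  {P : Measure Ω'} {ℱ : Filtration ℕ mΩ'} {price : ℕ → Ω' → ℝ}
  {adv : ℕ → Ω' → Fin m → Measure ℝ} {θ : ℕ → Ω' → ℝ} {ω : ℕ → Ω' → Fin m} {q : ℕ → Ω' → ℝ}

lemma IsRun.price_mem (h : IsRun additive 2 M ε T P ℱ price adv θ ω q) {n : ℕ} (h0 : 0 < ε)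
    (hε : n * ε = 1) {t : ℕ} (ht : t < T) (s : Ω') : price t s ∈ Icc (0 : ℝ) 2 := by
  rcases lt_or_ge t (typeGrid additive 2 M ε).card with h1 | h1
  · obtain ⟨e, he⟩ := h.init s
    exact (he t ht h1).1
  · obtain ⟨k, -, hk, hk'⟩ := (mem_priceGrid hε).1 (h.main s t ht h1).1.1
    rw [← hk']
    refine ⟨by positivity, ?_⟩
    calc (k : ℝ) * ε ≤ (2 * n : ℕ) * ε := by gcongr
      _ = 2 := by push_cast; linarith

/-- On the complement of the bad event the regret of a main round is at most a multiple of the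
expected confidence radius. -/
lemma IsRun.regret_le_of_notMem (h : IsRun additive 2 M ε T P ℱ price adv θ ω q) {n : ℕ}
    (h0 : 0 < ε) (hε : n * ε = 1) {t : ℕ} (ht : t < T)
    (htc : (typeGrid additive 2 M ε).card ≤ t) {s : Ω'}
    (h1 : ∀ x ∈ typeGrid additive 2 M ε, 1 ≤ count (point price q) x t s)
    (hs : s ∉ badEvent (point price q) (outcome price q θ) M.demand (typeGrid additive 2 M ε) T t) :
    optRev additive 2 M - rev additive M (price t s) (adv t s) ≤ 2 * ε + 20 * √(log T) *
      ∑ x ∈ typeGrid additive 2 M ε,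
        1 / √(count (point price q) x t s) * pointLaw M (price t s) (adv t s) x := by
  set S := typeGrid additive 2 M ε
  have hidx : ∀ x ∈ S, _ := fun x hx => index_bounds (θ := θ) (d := M.demand x) ht (h1 x hx) (by
    simp only [badEvent, mem_iUnion, not_exists] at hs
    by_contra hc
    exact hs x hx ⟨by linarith [h1 x hx], not_le.1 hc⟩)
  set I := index additive T (fun τ => price τ s) (fun τ => q τ s) (fun τ => θ τ s) t with hI
  set U := ucb additive S T (fun τ => price τ s) (fun τ => q τ s) (fun τ => θ τ s) t with hU
  have hopt := h.main s t ht htc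
  -- The minimum over `y ≤ x` preserves optimism because the demand at `y` is at least that at `x`.
  have hDU : ∀ x ∈ S, M.demand x ≤ U x := fun x _ => by
    refine (Finset.le_fold_min _).2 ⟨M.demand_le_one x, fun y hy => ?_⟩
    rw [Finset.mem_filter] at hy
    exact (M.demand_antitone hy.2).trans (hidx y hy.1).1
  have hUI : ∀ x ∈ S, U x ≤ I x := fun x hx =>
    (Finset.fold_min_le _).2 (.inr ⟨x, Finset.mem_filter.2 ⟨hx, le_rfl⟩, le_rfl⟩)
  have hle := optRev_le_estRev h0 hε hDU hopt
  have hp := h.price_mem h0 hε ht s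
  rw [rev_additive, estRev_eq_sum hopt.1.2]
  rw [estRev_eq_sum hopt.1.2] at hle
  have hsum : ∑ x ∈ S, U x * pointLaw M (price t s) (adv t s) x ≤
      ∑ x ∈ S, M.demand x * pointLaw M (price t s) (adv t s) x + 10 * √(log T) *
        ∑ x ∈ S, 1 / √(count (point price q) x t s) * pointLaw M (price t s) (adv t s) x := by
    rw [Finset.mul_sum, ← Finset.sum_add_distrib]
    refine Finset.sum_le_sum fun x hx => ?_
    calc _ ≤ (M.demand x + 10 * (√(log T) / √(count (point price q) x t s))) *
          pointLaw M (price t s) (adv t s) x :=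
          mul_le_mul_of_nonneg_right ((hUI x hx).trans (hidx x hx).2) (pointLaw_nonneg _ _ _ _)
      _ = _ := by ring
  have hR : 0 ≤ ∑ x ∈ S, 1 / √(count (point price q) x t s) *
      pointLaw M (price t s) (adv t s) x :=
    Finset.sum_nonneg fun x _ => mul_nonneg (by positivity) (pointLaw_nonneg _ _ _ _)
  set X := ∑ x ∈ S, U x * pointLaw M (price t s) (adv t s) x
  set Y := ∑ x ∈ S, M.demand x * pointLaw M (price t s) (adv t s) x
  set R := ∑ x ∈ S, 1 / √(count (point price q) x t s) * pointLaw M (price t s) (adv t s) x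
  have h2 : price t s * (X - Y) ≤ 2 * (10 * √(log T) * R) :=
    (mul_le_mul_of_nonneg_left (by linarith) hp.1).trans
      (mul_le_mul_of_nonneg_right hp.2 (by positivity))
  linarith

/-- The bad event has probability at most `2 / T ^ 2` and costs at most `2`. -/
lemma IsRun.integral_regret_le [IsProbabilityMeasure P]
    (h : IsRun additive 2 M ε T P ℱ price adv θ ω q) {n : ℕ} (h0 : 0 < ε) (hε : n * ε = 1)
    (hT : 2 ≤ T) {t : ℕ} (ht : t < T) (htc : (typeGrid additive 2 M ε).card ≤ t) :
    optRev additive 2 M - ∫ s, rev additive M (price t s) (adv t s) ∂P ≤ 2 * ε +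
      4 / (T : ℝ) ^ 2 + 20 * √(log T) * ∫ s, ∑ x ∈ typeGrid additive 2 M ε,
        hit (point price q) x t s / √(count (point price q) x t s) ∂P := by
  have hS := h.samples
  have hle := ℱ.le t
  have hone := h.ae_one_le_count (htc.trans ht.le)
  set S := typeGrid additive 2 M ε
  set K := point price q
  set E := badEvent K (outcome price q θ) M.demand S T t
  have hE : MeasurableSet E := hS.measurableSet_badEvent S ht.le
  have hPE : P.real E ≤ 2 / (T : ℝ) ^ 2 := hS.measure_badEvent_le hT (htc.trans ht.le) ht.le
  set Z : ℝ → Ω' → ℝ := fun x s => 1 / √(count K x t s)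
  have hZ : ∀ x, Measurable[ℱ t] (Z x) := fun x =>
    Measurable.div (m := ℱ t) measurable_const (hS.measurable_count x ht.le).sqrt
  have hZ' : ∀ x, Integrable (Z x) P := fun x =>
    .of_bound ((hZ x).mono hle le_rfl).aestronglyMeasurable 1
      (.of_forall (div_sqrt_count_le_one K x t))
  have hLm : ∀ x, Measurable fun s => pointLaw M (price t s) (adv t s) x := fun x =>
    (h.measurable_pointLaw ht htc x).mono hle le_rfl
  have hLi : ∀ x, Integrable (fun s => Z x s * pointLaw M (price t s) (adv t s) x) P := fun x =>
    (hZ' x).mul_bdd (c := 1) (hLm x).aestronglyMeasurable (.of_forall fun s => by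
      rw [norm_of_nonneg (pointLaw_nonneg _ _ _ _)]; exact h.pointLaw_le_one ht x s)
  have hhi : ∀ x, Integrable (fun s => Z x s * hit K x t s) P := fun x =>
    (hZ' x).mul_bdd (c := 1)
      ((hS.measurable_hit x (Nat.lt_succ_self t) ht).mono (ℱ.le _) le_rfl).aestronglyMeasurable
      (.of_forall fun s => by rw [norm_of_nonneg (hit_nonneg _ _ _ _)]; exact hit_le_one _ _ _ _)
  have hrev : ∀ s, rev additive M (price t s) (adv t s) =
      price t s * ∑ x ∈ S, M.demand x * pointLaw M (price t s) (adv t s) x := fun s => by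
    rw [rev_additive, estRev_eq_sum (h.main s t ht htc).1.2]
  have hrev0 : ∀ s, 0 ≤ rev additive M (price t s) (adv t s) := fun s =>
    rev_nonneg M (h.price_mem h0 hε ht s).1 _
  have hrev2 : ∀ s, rev additive M (price t s) (adv t s) ≤ 2 := fun s =>
    (rev_additive_le (h.price_mem h0 hε ht s).1 (h.main s t ht htc).1.2).trans
      (h.price_mem h0 hε ht s).2
  have hrevi : Integrable (fun s => rev additive M (price t s) (adv t s)) P := by
    refine .of_bound ?_ 2 (.of_forall fun s => by rw [norm_of_nonneg (hrev0 s)]; exact hrev2 s)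
    simp only [hrev]
    exact (((h.price_meas t ht).mono hle le_rfl).mul
      (Finset.measurable_fun_sum _ fun x _ => (hLm x).const_mul _)).aestronglyMeasurable
  -- The radius depends only on the past, so in expectation the conditional law of the critical type
  -- may be replaced by the realized visit.
  have hswap : ∫ s, ∑ x ∈ S, hit K x t s / √(count K x t s) ∂P =
      ∫ s, ∑ x ∈ S, Z x s * pointLaw M (price t s) (adv t s) x ∂P := by
    have : ∀ s, ∑ x ∈ S, hit K x t s / √(count K x t s) = ∑ x ∈ S, Z x s * hit K x t s :=
      fun s => Finset.sum_congr rfl fun x _ => by simp only [Z]; ring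
    simp only [this]
    rw [integral_finsetSum _ fun x _ => hhi x, integral_finsetSum _ fun x _ => hLi x]
    refine Finset.sum_congr rfl fun x _ => ?_
    have := M.typeLaw_prob
    simpa using h.integral_hit ht htc (hZ x) (div_sqrt_count_le_one K x t) MeasurableSet.univ x
  rw [hswap]
  have hsumi : Integrable (fun s => ∑ x ∈ S, Z x s * pointLaw M (price t s) (adv t s) x) P :=
    integrable_finsetSum _ fun x _ => hLi x
  have hEi : Integrable (E.indicator fun _ => (2 : ℝ)) P := (integrable_const _).indicator hE
  calc optRev additive 2 M - ∫ s, rev additive M (price t s) (adv t s) ∂P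
      = ∫ s, (optRev additive 2 M - rev additive M (price t s) (adv t s)) ∂P := by
        rw [integral_sub (integrable_const _) hrevi]; simp
    _ ≤ ∫ s, ((2 * ε + E.indicator (fun _ => (2 : ℝ)) s) + 20 * √(log T) *
          ∑ x ∈ S, Z x s * pointLaw M (price t s) (adv t s) x) ∂P := by
        refine integral_mono_ae ((integrable_const _).sub hrevi)
          (((integrable_const _).add hEi).add (hsumi.const_mul _)) ?_
        filter_upwards [hone] with s hs
        by_cases hsE : s ∈ E
        · have h1 : 0 ≤ ∑ x ∈ S, Z x s * pointLaw M (price t s) (adv t s) x :=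
            Finset.sum_nonneg fun x _ =>
              mul_nonneg (by simp only [Z]; positivity) (pointLaw_nonneg _ _ _ _)
          have h2 := optRev_le M
          have h3 := hrev0 s
          have h4 := mul_nonneg (sqrt_nonneg (log T)) h1
          rw [indicator_of_mem hsE]
          linarith
        · rw [indicator_of_notMem hsE, add_zero]
          exact h.regret_le_of_notMem h0 hε ht htc (hs t htc) hsE
    _ = 2 * ε + P.real E * 2 + 20 * √(log T) *
          ∫ s, ∑ x ∈ S, Z x s * pointLaw M (price t s) (adv t s) x ∂P := by
        rw [integral_add (f := fun s => 2 * ε + E.indicator (fun _ => (2 : ℝ)) s)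
          ((integrable_const _).add hEi) (hsumi.const_mul _),
          integral_add (integrable_const _) hEi, integral_const_mul (20 * √(log T)),
          integral_indicator_const _ hE]
        simp
    _ ≤ _ := by
        gcongr
        calc P.real E * 2 ≤ 2 / (T : ℝ) ^ 2 * 2 := by gcongr
          _ = 4 / (T : ℝ) ^ 2 := by ring

lemma log_natCast_ge {T : ℕ} (hT : 2 ≤ T) : 1 / 4 ≤ log T := by
  have h1 : log 2 ≤ log T := log_le_log (by norm_num) (by exact_mod_cast hT)
  linarith [log_two_gt_d9]

/-- In units of `√(|𝒮| T log T)`: the initial rounds cost `4`, the bad events `4` and the radii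
`60`. -/
theorem IsRun.regret_le [IsProbabilityMeasure P]
    (h : IsRun additive 2 M ε T P ℱ price adv θ ω q) {n : ℕ} (h0 : 0 < ε) (hε : n * ε = 1)
    (hT : 2 ≤ T) : regret additive 2 M T P price adv ≤
      2 * ε * T + 68 * √((typeGrid additive 2 M ε).card * T * log T) := by
  have hS := h.samples
  set S := typeGrid additive 2 M ε
  have hT0 : (2 : ℝ) ≤ T := by exact_mod_cast hT
  have hlog := log_natCast_ge hT
  have hcard : (1 : ℝ) ≤ S.card := by
    exact_mod_cast Finset.card_pos.2 ⟨_, mul_mem_typeGrid M hε (Nat.zero_le n)⟩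
  have hsq : √(S.card * T) ≤ 2 * √(S.card * T * log T) := by
    rw [show (2 : ℝ) = √(2 ^ 2) by rw [sqrt_sq (by norm_num)], ← sqrt_mul (by norm_num)]
    apply sqrt_le_sqrt
    have : 0 ≤ (S.card : ℝ) * T := by positivity
    nlinarith
  have h1sq : 1 ≤ √(S.card * T) := one_le_sqrt.2 (by nlinarith)
  have hinit : ∀ t < T, optRev additive 2 M - ∫ s, rev additive M (price t s) (adv t s) ∂P ≤ 2 :=
    fun t ht => by
      have := integral_nonneg (μ := P) (f := fun s => rev additive M (price t s) (adv t s))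
        fun s => rev_nonneg M (h.price_mem h0 hε ht s).1 _
      linarith [optRev_le M]
  have hreg : regret additive 2 M T P price adv = ∑ t ∈ Finset.range T,
      (optRev additive 2 M - ∫ s, rev additive M (price t s) (adv t s) ∂P) := by
    rw [regret, Finset.sum_sub_distrib, Finset.sum_const, Finset.card_range, nsmul_eq_mul]
  rw [hreg]
  have hεT : 0 ≤ 2 * ε * T := by positivity
  have hinit_sum : ∀ k ≤ T, ∑ t ∈ Finset.range k,
      (optRev additive 2 M - ∫ s, rev additive M (price t s) (adv t s) ∂P) ≤ 2 * k :=
    fun k hk => (Finset.sum_le_sum fun t ht =>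
      hinit t ((Finset.mem_range.1 ht).trans_le hk)).trans_eq (by simp [mul_comm])
  -- If `T ≤ |𝒮|` the initial rounds fill the horizon, and the trivial bound `2T` suffices.
  rcases le_total T S.card with hc | hc
  · have h1 : (T : ℝ) ≤ √(S.card * T) := le_sqrt_of_sq_le (by
      rw [sq]; gcongr)
    linarith [hinit_sum T le_rfl]
  · rw [← Finset.sum_range_add_sum_Ico _ hc]
    have h1 : (S.card : ℝ) ≤ √(S.card * T) := le_sqrt_of_sq_le (by
      rw [sq]; gcongr)
    have hi : ∀ t ∈ Finset.Ico S.card T, Integrable (fun s => ∑ x ∈ S,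
        hit (point price q) x t s / √(count (point price q) x t s)) P := fun t ht => by
      have htT := (Finset.mem_Ico.1 ht).2
      refine integrable_finsetSum _ fun x _ => .of_bound
        (((hS.measurable_hit x (Nat.lt_succ_self t) htT).mono (ℱ.le _) le_rfl).div
          ((hS.measurable_count x htT.le).mono (ℱ.le _) le_rfl).sqrt).aestronglyMeasurable 1
        (.of_forall fun s => ?_)
      rw [div_eq_mul_one_div, norm_mul, norm_of_nonneg (hit_nonneg _ _ _ _)]
      exact mul_le_one₀ (hit_le_one _ _ _ _) (norm_nonneg _) (div_sqrt_count_le_one _ x t s)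
    have h2 : ∑ t ∈ Finset.Ico S.card T, ∫ s, ∑ x ∈ S,
        hit (point price q) x t s / √(count (point price q) x t s) ∂P ≤ 3 * √(S.card * T) := by
      rw [← integral_finsetSum _ hi]
      calc _ ≤ ∫ _, 3 * √(S.card * T) ∂P := by
            refine integral_mono_ae (integrable_finsetSum _ hi) (integrable_const _) ?_
            filter_upwards [h.ae_one_le_count hc] with s hs
            exact sum_hit_div_sqrt_count_le _ S S.card T s hs
        _ = _ := by simp
    have h3 : ∑ t ∈ Finset.Ico S.card T,
        (optRev additive 2 M - ∫ s, rev additive M (price t s) (adv t s) ∂P) ≤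
        T * (2 * ε + 4 / (T : ℝ) ^ 2) + 20 * √(log T) * (3 * √(S.card * T)) := by
      calc _ ≤ ∑ t ∈ Finset.Ico S.card T, ((2 * ε + 4 / (T : ℝ) ^ 2) + 20 * √(log T) *
            ∫ s, ∑ x ∈ S, hit (point price q) x t s / √(count (point price q) x t s) ∂P) :=
            Finset.sum_le_sum fun t ht => h.integral_regret_le h0 hε hT (Finset.mem_Ico.1 ht).2
              (Finset.mem_Ico.1 ht).1
        _ ≤ _ := by
            rw [Finset.sum_add_distrib, ← Finset.mul_sum, Finset.sum_const, Nat.card_Ico,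
              nsmul_eq_mul]
            gcongr
            exact Nat.sub_le _ _
    have h4 : (T : ℝ) * (2 * ε + 4 / (T : ℝ) ^ 2) ≤ 2 * ε * T + 2 := by
      have : (T : ℝ) * (4 / (T : ℝ) ^ 2) ≤ 2 := by
        rw [sq, ← div_div, mul_div_cancel₀ _ (by linarith), div_le_iff₀ (by linarith)]
        linarith
      linarith
    have h5 : √(log T) * √(S.card * T) = √(S.card * T * log T) := by
      rw [mul_comm, ← sqrt_mul (by positivity)]
    linarith [hinit_sum S.card hc]

end Run

/-! ### The choice of the discretization parameter -/

lemma scale_pos {m T : ℕ} (hm : 2 ≤ m) (hT : 2 ≤ T) : 0 < scale m T := by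
  have hlog : 0 < log T := by linarith [log_natCast_ge hT]
  have hT0 : (0 : ℝ) < T := by positivity
  exact lt_min (rpow_pos_of_pos (by positivity) _) (by positivity)

lemma exists_parameter {m T : ℕ} (hm : 2 ≤ m) (hT : 2 ≤ T) : ∃ ε : ℝ,
    (1 / 2) * scale m T ≤ ε ∧ ε ≤ scale m T ∧ ∃ K : ℕ, (K : ℝ) * ε = 1 / ((m : ℝ) - 1) := by
  have hg := scale_pos hm hT
  have hgm : scale m T ≤ 1 / m := min_le_right _ _
  set g := scale m T
  have hm' : (2 : ℝ) ≤ m := by exact_mod_cast hm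
  set r : ℝ := 1 / ((m : ℝ) - 1) with hr
  have hr0 : 0 < r := by
    have : (0 : ℝ) < m - 1 := by linarith
    positivity
  have hgr : g ≤ r := hgm.trans (one_div_le_one_div_of_le (by linarith) (by linarith))
  have h1 : 1 ≤ r / g := (one_le_div hg).2 hgr
  -- As `r / g ≥ 1`, rounding up at most doubles it, so `r / k` lies in `[g / 2, g]`.
  set k := ⌈r / g⌉₊
  have hk : r / g ≤ k := Nat.le_ceil _
  have hk' : (k : ℝ) < r / g + 1 := Nat.ceil_lt_add_one (by linarith)
  have hk0 : (0 : ℝ) < k := by linarith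
  refine ⟨r / k, ?_, ?_, k, by field_simp⟩
  · rw [le_div_iff₀ hk0]
    have h2 : r / g * g = r := div_mul_cancel₀ _ hg.ne'
    nlinarith
  · rw [div_le_iff₀ hk0]
    rwa [div_le_iff₀ hg, mul_comm] at hk

lemma EquallySpaced.quality_eq {m : ℕ} {M : Market m} (h : EquallySpaced M.quality) (i : Fin m) :
    M.quality i = i / ((m : ℝ) - 1) := by
  have hm := M.two_le
  obtain ⟨c, hc⟩ := h
  have h0 : M.quality ⟨0, by omega⟩ = 0 := by
    obtain ⟨j, hj⟩ := M.quality_least.1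
    refine le_antisymm ?_ (M.quality_mem _).1
    rw [← hj]
    exact M.quality_strictMono.monotone (Fin.mk_le_of_le_val (Nat.zero_le _))
  have h1 : M.quality ⟨m - 1, by omega⟩ = 1 := by
    obtain ⟨j, hj⟩ := M.quality_greatest.1
    refine le_antisymm (M.quality_mem _).2 ?_
    rw [← hj]
    exact M.quality_strictMono.monotone (Fin.le_def.2 (by have := j.2; simp only; omega))
  have hlin : ∀ k : ℕ, ∀ hk : k < m, M.quality ⟨k, hk⟩ = k * c := by
    intro k
    induction k with
    | zero => intro hk; simpa using h0
    | succ k ih =>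
      intro hk
      have h2 := hc ⟨k, by omega⟩ ⟨k + 1, hk⟩ rfl
      rw [ih (by omega)] at h2
      push_cast
      linarith
  have hm1 : ((m - 1 : ℕ) : ℝ) = (m : ℝ) - 1 := by push_cast [show 1 ≤ m by omega]; ring
  have hm' : (0 : ℝ) < (m : ℝ) - 1 := by
    have : (2 : ℝ) ≤ m := by exact_mod_cast hm
    linarith
  have h2 := hlin (m - 1) (by omega)
  rw [h1, hm1] at h2
  rw [show i = ⟨i, i.2⟩ from rfl, hlin i i.2, eq_div_iff hm'.ne', mul_assoc, mul_comm c, ← h2,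
    mul_one]

lemma regret_le_of_equallySpaced {m T : ℕ} {M : Market m} (hM : EquallySpaced M.quality)
    (hT : 2 ≤ T) {ε : ℝ} (h0 : 0 < ε) {k : ℕ} (hk : (k : ℝ) * ε = 1 / ((m : ℝ) - 1))
    {Ω' : Type*} [mΩ' : MeasurableSpace Ω'] {P : Measure Ω'} [IsProbabilityMeasure P]
    {ℱ : Filtration ℕ mΩ'} {price : ℕ → Ω' → ℝ} {adv : ℕ → Ω' → Fin m → Measure ℝ}
    {θ : ℕ → Ω' → ℝ} {ω : ℕ → Ω' → Fin m} {q : ℕ → Ω' → ℝ}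
    (h : IsRun additive 2 M ε T P ℱ price adv θ ω q) :
    regret additive 2 M T P price adv ≤ 2 * ε * T + 68 * √(2 / ε * (T * log T)) := by
  have hm := M.two_le
  have hm' : (2 : ℝ) ≤ m := by exact_mod_cast hm
  have hε : ((m - 1) * k : ℕ) * ε = 1 := by
    push_cast [show 1 ≤ m by omega]
    rw [mul_assoc, hk, mul_one_div_cancel (by linarith)]
  have hq : ∀ i, ∃ j : ℕ, M.quality i = j * ε := fun i => ⟨i * k, by
    rw [hM.quality_eq i]; push_cast; rw [mul_assoc, hk]; ring⟩
  refine (h.regret_le h0 hε hT).trans ?_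
  have hcard := card_typeGrid_le M h0 hε hq
  set n := (m - 1) * k
  have hn : 1 ≤ n := Nat.one_le_iff_ne_zero.2 (by intro h; simp [h] at hε)
  -- The grid has at most `n + 1 ≤ 2n` points, with `n = 1 / ε`.
  have hc : ((typeGrid additive 2 M ε).card : ℝ) ≤ 2 / ε := by
    have h1 : (2 : ℝ) / ε = (2 * n : ℕ) := by
      rw [div_eq_iff h0.ne']; push_cast; linarith
    rw [h1]
    exact_mod_cast hcard.trans (by omega)
  have hlog : 0 ≤ log T := by linarith [log_natCast_ge hT]
  rw [mul_assoc ((typeGrid additive 2 M ε).card : ℝ)]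
  gcongr

end Persuasion

/-! ### Balancing the two losses -/

theorem mainTheorem3 :
    -- a parameter `ε = Θ((log T / T)^{1/3} ∧ 1/m)` that divides the spacing `1 / (m - 1)` exists
    (∀ m T : ℕ, 2 ≤ m → 2 ≤ T → ∃ ε : ℝ,
      (1 / 2) * Persuasion.scale m T ≤ ε ∧ ε ≤ Persuasion.scale m T ∧
      ∃ K : ℕ, (K : ℝ) * ε = 1 / ((m : ℝ) - 1)) ∧
    -- each such parameter gives the regret bounds
    ∀ c₁ c₂ : ℝ, 0 < c₁ → 0 < c₂ → ∃ C : ℝ, 0 < C ∧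
      ∀ (m T : ℕ) (M : Persuasion.Market m), Persuasion.EquallySpaced M.quality → 2 ≤ T →
      ∀ ε : ℝ, c₁ * Persuasion.scale m T ≤ ε → ε ≤ c₂ * Persuasion.scale m T →
      (∃ K : ℕ, (K : ℝ) * ε = 1 / ((m : ℝ) - 1)) →
      ∀ (Ω' : Type*) (mΩ' : MeasurableSpace Ω') (P : Measure Ω') (_ : IsProbabilityMeasure P)
        (ℱ : Filtration ℕ mΩ') (price : ℕ → Ω' → ℝ) (adv : ℕ → Ω' → Fin m → Measure ℝ)
        (θ : ℕ → Ω' → ℝ) (ω : ℕ → Ω' → Fin m) (q : ℕ → Ω' → ℝ),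
      Persuasion.IsRun Persuasion.additive 2 M ε T P ℱ price adv θ ω q →
        Persuasion.regret Persuasion.additive 2 M T P price adv ≤
          C * ((T : ℝ) ^ (2 / 3 : ℝ) * (log T) ^ (1 / 3 : ℝ) + √(m * T * log T)) ∧
        ((m : ℝ) ≤ (T / log T) ^ (1 / 3 : ℝ) →
          Persuasion.regret Persuasion.additive 2 M T P price adv ≤
            C * ((T : ℝ) ^ (2 / 3 : ℝ) * (log T) ^ (1 / 3 : ℝ))) ∧
        ((T / log T : ℝ) ^ (1 / 3 : ℝ) < m →
          Persuasion.regret Persuasion.additive 2 M T P price adv ≤ C * √(m * T * log T)) := by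
  refine ⟨fun m T hm hT => Persuasion.exists_parameter hm hT, fun c₁ c₂ hc₁ hc₂ => ?_⟩
  set C₀ := 2 * c₂ + 68 * √(2 / c₁) with hC₀
  have hC₀pos : 0 < C₀ := by positivity
  -- The factor `2` serves the two regimes, in each of which one term dominates the other.
  refine ⟨2 * C₀, by positivity, ?_⟩
  rintro m T M hM hT ε h1 h2 ⟨k, hk⟩ Ω' mΩ' P hP ℱ price adv θ ω q h
  have hm := M.two_le
  have hg := Persuasion.scale_pos hm hT
  have h0 : 0 < ε := (mul_pos hc₁ hg).trans_le h1
  have hreg := Persuasion.regret_le_of_equallySpaced hM hT h0 hk h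
  have hT0 : (0 : ℝ) < T := by positivity
  have hm0 : (0 : ℝ) < m := by positivity
  have hlog : 0 < log T := by linarith [Persuasion.log_natCast_ge hT]
  -- At `ε = u` both losses `εT` and `√(T log T / ε)` equal `T * u = T^{2/3} (log T)^{1/3}`.
  set u : ℝ := (log T / T) ^ (1 / 3 : ℝ) with hu
  have hu0 : 0 < u := rpow_pos_of_pos (by positivity) _
  have hu3 : u ^ 3 * T = log T := by
    rw [hu, ← rpow_natCast, ← rpow_mul (by positivity)]
    norm_num
    field_simp
  have hinv : (T / log T : ℝ) ^ (1 / 3 : ℝ) = 1 / u := by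
    rw [hu, one_div (_ ^ _), ← inv_rpow (by positivity), inv_div]
  have hA : (T : ℝ) ^ (2 / 3 : ℝ) * (log T) ^ (1 / 3 : ℝ) = T * u := by
    rw [hu, div_rpow hlog.le hT0.le, ← mul_div_assoc, mul_comm (T : ℝ), mul_div_assoc, mul_comm,
      show (2 / 3 : ℝ) = 1 - 1 / 3 by norm_num, rpow_sub hT0, rpow_one]
  have hsq : √((T * u) ^ 2) = T * u := sqrt_sq (by positivity)
  have hu2 : 1 / u * (T * log T) = (T * u) ^ 2 := by
    rw [← hu3]; field_simp
  rw [hinv, hA]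
  -- The reciprocal of the minimum is the maximum of `1 / u` and `m`; their sum yields the two terms
  -- of the bound.
  have hginv : 1 / Persuasion.scale m T ≤ 1 / u + m := by
    rcases min_choice u (1 / m : ℝ) with h3 | h3
    · rw [Persuasion.scale, h3]; linarith
    · rw [Persuasion.scale, h3, one_div_one_div]
      have : 0 < 1 / u := by positivity
      linarith
  have hTl : 0 < T * log T := by positivity
  have hroot : √(2 / ε * (T * log T)) ≤ √(2 / c₁) * (T * u + √(m * T * log T)) := by
    have h3 : 2 / ε ≤ 2 / c₁ * (1 / u + m) := by
      calc 2 / ε ≤ 2 / (c₁ * Persuasion.scale m T) := by gcongr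
        _ = 2 / c₁ * (1 / Persuasion.scale m T) := by field_simp
        _ ≤ _ := by gcongr
    calc _ ≤ √(2 / c₁ * (1 / u + m) * (T * log T)) := by gcongr
      _ = √(2 / c₁) * √((T * u) ^ 2 + m * T * log T) := by
          rw [← sqrt_mul (by positivity), ← hu2]; ring_nf
      _ ≤ √(2 / c₁) * (√((T * u) ^ 2) + √(m * T * log T)) := by
          gcongr
          rw [sqrt_le_left (by positivity), add_sq, sq_sqrt (by positivity), sq_sqrt (by positivity)]
          have := mul_nonneg (sqrt_nonneg ((T * u) ^ 2)) (sqrt_nonneg (m * T * log T))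
          linarith
      _ = _ := by rw [hsq]
  have hεT : 2 * ε * T ≤ 2 * c₂ * (T * u) := by
    have : ε ≤ c₂ * u := h2.trans (by gcongr; exact min_le_left _ _)
    calc 2 * ε * T ≤ 2 * (c₂ * u) * T := by gcongr
      _ = _ := by ring
  set R := Persuasion.regret Persuasion.additive 2 M T P price adv
  set V := √(m * T * log T) with hV
  have hV0 : 0 ≤ V := sqrt_nonneg _
  have hTu : 0 < T * u := by positivity
  have hmain : R ≤ C₀ * (T * u + V) := by
    have := mul_nonneg hc₂.le hV0
    rw [hC₀]
    linarith
  refine ⟨?_, fun h3 => ?_, fun h3 => ?_⟩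
  · have := mul_nonneg hC₀pos.le (add_nonneg hTu.le hV0)
    linarith
  · have hVu : V ≤ T * u := by
      rw [← hsq, hV, ← hu2, mul_assoc]
      gcongr
    have := mul_le_mul_of_nonneg_left hVu hC₀pos.le
    linarith
  · have hVu : T * u ≤ V := by
      rw [← hsq, hV, ← hu2, mul_assoc]
      gcongr
    have := mul_le_mul_of_nonneg_left hVu hC₀pos.le
    linarith
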